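/- Let $(n_k)$, $(p_k)$ be sequences of natural numbers with $n=n_k\to\infty$ and $p/n=p_k/n_k\to\gamma\in(0,1)$, let $\sigma>0$ and $\tau,c\in\mathbb R$ be fixed, and let $\Sigma=\Sigma_k$ be symmetric positive definite $p\times p$ matrices with $\operatorname{tr}\Sigma\to c^2$. **Model.** The coefficient vector $\beta\in\mathbb R^p$ is random with law $P_\beta$, $\mathbb E[\beta]=0$ and $\mathbb E[\beta\beta^T]=\tau^2I_p$. Independently of $\beta$, the covariates $x_1,\dots,x_n$ and $x_0$ are i.i.d. $N(0,\Sigma)$. Given $\beta$ and $x_1,\dots,x_n$, the responses $y_1,\dots,y_n$ are independent, and the conditional law of $y_i$ depends only on $(\beta,x_i)$, with mean $x_i^T\beta$ and variance $\sigma^2$; otherwise it is arbitrary. The covariate $x_0$ is independent of all the other variables. ($P_\beta$ and the conditional laws may vary with $k$.) **Estimators.** Let $X$ be the $n\times p$ matrix with rows $x_i^T$, $Y=(y_1,\dots,y_n)^T$, $\overline X=\frac1n\sum_i x_i$, $\overline Y=\frac1n\sum_i y_i$ and $H=\mathbb E[X^TX]$. Put $$\hat\beta=(X^TX)^{-1}X^TY,\qquad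 \breve\beta=H^{-1}\bigl(X^TY-n\,\overline X\,\overline Y\bigr),\qquad \dot\beta_\alpha=(1-\alpha)\hat\beta+\alpha\breve\beta .$$ The reducible prediction error of an estimator $\beta_T$ is $r(\beta_T)=\mathbb E\bigl[(x_0^T\beta_T-x_0^T\beta)^2\bigr]$, the expectation being over $\beta,X,Y$ and $x_0$. Let $$\alpha^*=\operatorname*{arg\,min}_{\alpha\in\mathbb R} r(\dot\beta_\alpha),\qquad \eta=\frac{r(\dot\beta_{\alpha^*})}{r(\hat\beta)} .$$ **Claim.** For all sufficiently large $k$ these quantities are well defined: $0<r(\hat\beta)<\infty$, the minimizer $\alpha^*$ exists and is unique, and it lies in $[0,1]$. Moreover, as $k\to\infty$, $$\eta\to\eta_\infty=1-\frac{\gamma^4\sigma^2}{(1-\gamma)\gamma^2\tau^2c^2+\gamma^3\sigma^2}<1,\qquad \alpha^*\to\alpha^*_\infty=\frac{\gamma^2\sigma^2}{(1-\gamma)\gamma\tau^2c^2+\gamma^2\sigma^2}.$$ -/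

import Mathlib

open MeasureTheory ProbabilityTheory Filter Topology
open scoped ENNReal Matrix

noncomputable section

namespace MixedSSL

variable {n p : ℕ}

/-- The design matrix whose rows are the covariate vectors `x₁, …, xₙ`. -/
def designMatrix (xs : Fin n → EuclideanSpace ℝ (Fin p)) : Matrix (Fin n) (Fin p) ℝ :=
  Matrix.of fun i j => xs i j

/-- `H = 𝔼[XᵀX]`, where `X` has `n` i.i.d. rows with law `Px`. -/
def expectedGram (n : ℕ) (Px : Measure (EuclideanSpace ℝ (Fin p))) :
    Matrix (Fin p) (Fin p) ℝ :=
  Matrix.of fun j k =>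
    ∫ xs : Fin n → EuclideanSpace ℝ (Fin p),
      ((designMatrix xs)ᵀ * designMatrix xs) j k ∂(Measure.pi fun _ => Px)

/-- The supervised (OLS) estimator `(XᵀX)⁻¹XᵀY`. -/
def supervisedEstimator (xs : Fin n → EuclideanSpace ℝ (Fin p)) (y : Fin n → ℝ) :
    Fin p → ℝ :=
  ((designMatrix xs)ᵀ * designMatrix xs)⁻¹ *ᵥ ((designMatrix xs)ᵀ *ᵥ y)

/-- The vector `X̄` of column means of the design matrix. -/
def covariateMean (xs : Fin n → EuclideanSpace ℝ (Fin p)) : Fin p → ℝ :=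
  fun j => (∑ i, xs i j) / n

/-- The mean response `Ȳ`. -/
def responseMean (y : Fin n → ℝ) : ℝ := (∑ i, y i) / n

/-- The semi-supervised estimator `H⁻¹(XᵀY - n X̄ Ȳ)`, with `H = 𝔼[XᵀX]` known. -/
def semiSupervisedEstimator (Px : Measure (EuclideanSpace ℝ (Fin p)))
    (xs : Fin n → EuclideanSpace ℝ (Fin p)) (y : Fin n → ℝ) : Fin p → ℝ :=
  (expectedGram n Px)⁻¹ *ᵥ
    ((designMatrix xs)ᵀ *ᵥ y - ((n : ℝ) * responseMean y) • covariateMean xs)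

/-- The linear-mixed estimator with mixing ratio `α`. -/
def mixedEstimator (Px : Measure (EuclideanSpace ℝ (Fin p))) (α : ℝ)
    (xs : Fin n → EuclideanSpace ℝ (Fin p)) (y : Fin n → ℝ) : Fin p → ℝ :=
  (1 - α) • supervisedEstimator xs y + α • semiSupervisedEstimator Px xs y

/-- The prior of the coefficient vector: `𝔼[β] = 0` and `𝔼[ββᵀ] = τ² I`. -/
structure IsIsotropicPrior (τ : ℝ) (Pβ : Measure (EuclideanSpace ℝ (Fin p))) : Prop where
  isProbabilityMeasure : IsProbabilityMeasure Pβ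
  memLp : MemLp id 2 Pβ
  mean : ∀ j, ∫ β, β j ∂Pβ = 0
  secondMoment : ∀ j k, ∫ β, β j * β k ∂Pβ = τ ^ 2 * (1 : Matrix (Fin p) (Fin p) ℝ) j k

/-- `κ (β, x)` is the law of the response `y` at the covariate `x` when the coefficient vector is
`β`. It has mean `xᵀβ` and variance `σ²`, and is otherwise arbitrary. -/
structure IsLinearResponse (σ : ℝ) (Pβ Px : Measure (EuclideanSpace ℝ (Fin p)))
    (κ : Kernel (EuclideanSpace ℝ (Fin p) × EuclideanSpace ℝ (Fin p)) ℝ) : Prop where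
  isMarkovKernel : IsMarkovKernel κ
  memLp : ∀ᵐ β ∂Pβ, ∀ᵐ x ∂Px, MemLp id 2 (κ (β, x))
  mean : ∀ᵐ β ∂Pβ, ∀ᵐ x ∂Px, ∫ y, y ∂(κ (β, x)) = x.ofLp ⬝ᵥ β.ofLp
  variance : ∀ᵐ β ∂Pβ, ∀ᵐ x ∂Px, Var[id; κ (β, x)] = σ ^ 2

/-- The reducible error `r(β_T) = 𝔼[(x₀ᵀβ_T - x₀ᵀβ)²]` of an estimator `β_T = est X Y`.
The expectation is over a coefficient vector `β ∼ Pβ`, an independent design `X` with i.i.d.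
rows `xᵢ ∼ Px`, responses `yᵢ ∼ κ (β, xᵢ)` that are independent given `β` and `X`, and an
independent covariate `x₀ ∼ Px`. -/
def reducibleError (Pβ Px : Measure (EuclideanSpace ℝ (Fin p)))
    (κ : Kernel (EuclideanSpace ℝ (Fin p) × EuclideanSpace ℝ (Fin p)) ℝ)
    (est : (Fin n → EuclideanSpace ℝ (Fin p)) → (Fin n → ℝ) → Fin p → ℝ) : ℝ≥0∞ :=
  ∫⁻ β, ∫⁻ xs : Fin n → EuclideanSpace ℝ (Fin p), ∫⁻ y : Fin n → ℝ, ∫⁻ x₀,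
    ENNReal.ofReal ((x₀.ofLp ⬝ᵥ est xs y - x₀.ofLp ⬝ᵥ β.ofLp) ^ 2)
    ∂Px ∂(Measure.pi fun i => κ (β, xs i)) ∂(Measure.pi fun _ => Px) ∂Pβ

/-- `α` is an optimal mixing ratio `α*` for training sets of size `n`: a global minimizer of
the reducible error of the linear-mixed estimator. -/
def IsOptimalMixingRatio (n : ℕ) (Pβ Px : Measure (EuclideanSpace ℝ (Fin p)))
    (κ : Kernel (EuclideanSpace ℝ (Fin p) × EuclideanSpace ℝ (Fin p)) ℝ) (α : ℝ) : Prop :=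
  ∀ α' : ℝ, reducibleError Pβ Px κ (mixedEstimator (n := n) Px α) ≤
    reducibleError Pβ Px κ (mixedEstimator (n := n) Px α')

/-- The ratio of the reducible errors of the linear-mixed estimator with mixing ratio `α` and of
the supervised estimator. At `α = α*` this is `η`. -/
def relativeError (n : ℕ) (Pβ Px : Measure (EuclideanSpace ℝ (Fin p)))
    (κ : Kernel (EuclideanSpace ℝ (Fin p) × EuclideanSpace ℝ (Fin p)) ℝ) (α : ℝ) : ℝ :=
  (reducibleError Pβ Px κ (mixedEstimator (n := n) Px α) /
    reducibleError Pβ Px κ (supervisedEstimator (n := n))).toReal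

end MixedSSL

end

/-!
Write `X` for the design, `ε` for the noise and `P` for the centering matrix `I - 11ᵀ / n`.
Put `R = Σ ^ (1 / 2)` and `Z = X R⁻¹`, whose entries are independent standard normal variables.
Integrating the squared prediction error over `x₀` gives `‖R (est - β)‖²`, and
(`mulVec_mixedEstimator_sub`)
`R (est - β) = α (ZᵀPZ / n - I) R β + ((1 - α) (ZᵀZ)⁻¹ Zᵀ + (α / n) ZᵀP) ε`,
so that, after integration over the responses, the risk is a squared bias plus `σ²` times the
squared Frobenius norm of the noise matrix (`whitenedRisk_columns`). This holds for every
conditional law of the responses with the given mean and variance.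

The Gaussian design enters through four means, all computed for the columns of `Z`, which are
independent standard Gaussian vectors of `ℝⁿ`.

* `𝔼 tr (ZᵀZ)⁻¹ = p / (n - p - 1)`: a diagonal entry of an inverse Gram matrix is the inverse squared
  distance of a column to the span of the others (`inv_gram_apply_self`). Given the others, this
  distance is the length of a standard Gaussian vector of dimension `d = n - p + 1`, and
  `𝔼 ‖g‖⁻² = 1 / (d - 2)` (`lintegral_inv_norm_sq_stdGaussian`). The argument also gives linear
  independence of the columns almost surely, by induction on their number.
* `𝔼 tr ((ZᵀZ)⁻¹ ZᵀPZ) = p - p / n`: the trace is `p` minus the squared length of the projection of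
  a fixed unit vector to the column space, and by rotation invariance this length has mean `p / n`
  (`lintegral_spanLeverage`).
* `𝔼 tr ZᵀPZ = p (n - 1)`, and `𝔼 ‖(ZᵀPZ / n - I) b‖² = s ‖b‖²` where `s → γ`
  (`integral_wishartDeviation_mulVec`): the projected columns are standard Gaussian vectors of a space
  of dimension `n - 1`, and mixed second moments vanish by symmetry under sign changes.

Hence the reducible error is a quadratic polynomial in `α`. The covariance of the errors of the two
estimators equals the noise part `C` of the semi-supervised error, so that with `A` the supervised
error and `v` the bias part of the semi-supervised error the polynomial is
`A - 2 α (A - C) + α² (A - C + v)` (`mixedRisk_eq`). As `C < A` and `0 ≤ v`, its unique minimizer is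
`(A - C) / (A - C + v)`, which lies in `[0, 1]`. As `A → σ² γ / (1 - γ)`,
`C → σ² γ` and `v → γ τ² c²`, the limits of the minimizer and of the relative error follow.
-/

namespace MixedSSL

/-! ### Gaussian Laplace transforms and inverse chi-squared means -/

/-- Holds for `a = 0` as well: both sides are then `∞`. -/
lemma lintegral_exp_neg_mul_Ioi {a : ℝ} (ha : 0 ≤ a) :
    ∫⁻ t in Set.Ioi (0 : ℝ), ENNReal.ofReal (Real.exp (-t * a)) = (ENNReal.ofReal a)⁻¹ := by
  rcases ha.eq_or_lt with rfl | ha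
  · simp
  · have h1 := integrableOn_exp_mul_Ioi (neg_lt_zero.2 ha) 0
    have h2 := integral_exp_mul_Ioi (neg_lt_zero.2 ha) 0
    have e : ∀ t : ℝ, -t * a = -a * t := fun t => by ring
    simp_rw [e]
    rw [← ofReal_integral_eq_lintegral_ofReal h1 (ae_of_all _ fun t => (Real.exp_pos _).le), h2,
      ← ENNReal.ofReal_inv_of_pos ha]
    simp [neg_div_neg_eq]

lemma integral_exp_neg_mul_sq_gaussianReal {t : ℝ} (ht : 0 ≤ t) :
    ∫ x, Real.exp (-t * x ^ 2) ∂(gaussianReal 0 1) = (√(1 + 2 * t))⁻¹ := by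
  rw [integral_gaussianReal_eq_integral_smul one_ne_zero]
  have e : ∀ x : ℝ, gaussianPDFReal 0 1 x • Real.exp (-t * x ^ 2)
      = (√(2 * Real.pi))⁻¹ * Real.exp (-(1 / 2 + t) * x ^ 2) := fun x => by
    simp only [gaussianPDFReal, smul_eq_mul, mul_assoc, ← Real.exp_add, NNReal.coe_one, mul_one,
      sub_zero]
    congr 2
    ring
  simp_rw [e]
  rw [integral_const_mul, integral_gaussian, ← Real.sqrt_inv, ← Real.sqrt_inv,
    ← Real.sqrt_mul (by positivity)]
  congr 1
  have := Real.pi_pos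
  field_simp

section

variable {E : Type*} [NormedAddCommGroup E] [InnerProductSpace ℝ E] [FiniteDimensional ℝ E]
  [MeasurableSpace E] [BorelSpace E]

lemma integral_exp_neg_mul_norm_sq_stdGaussian {t : ℝ} (ht : 0 ≤ t) :
    ∫ x, Real.exp (-t * ‖x‖ ^ 2) ∂(stdGaussian E) = (√(1 + 2 * t))⁻¹ ^ Module.finrank ℝ E := by
  rw [stdGaussian, integral_map (Measurable.aemeasurable (by fun_prop))
    (Measurable.aestronglyMeasurable (by fun_prop))]
  have e : ∀ x : Fin (Module.finrank ℝ E) → ℝ,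
      ‖∑ i, x i • stdOrthonormalBasis ℝ E i‖ ^ 2 = ∑ i, x i ^ 2 := fun x => by
    rw [← real_inner_self_eq_norm_sq, (stdOrthonormalBasis ℝ E).orthonormal.inner_sum]
    simp [sq]
  simp_rw [e, Finset.mul_sum, Real.exp_sum]
  rw [integral_fintype_prod_eq_prod (f := fun _ x => Real.exp (-t * x ^ 2))]
  simp only [integral_exp_neg_mul_sq_gaussianReal ht, Finset.prod_const, Finset.card_univ,
    Fintype.card_fin]

lemma lintegral_inv_sqrt_pow_Ioi {d : ℕ} (hd : 3 ≤ d) :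
    ∫⁻ t in Set.Ioi (0 : ℝ), ENNReal.ofReal ((√(1 + 2 * t))⁻¹ ^ d)
      = ENNReal.ofReal (1 / ((d : ℝ) - 2)) := by
  have hd' : (0 : ℝ) < (d : ℝ) - 2 := by
    have : (3 : ℝ) ≤ d := by exact_mod_cast hd
    linarith
  set g : ℝ → ℝ := fun t => -(1 / ((d : ℝ) - 2)) * (1 + 2 * t) ^ (-(((d : ℝ) - 2) / 2)) with hg
  have hder : ∀ t ∈ Set.Ici (0 : ℝ), HasDerivAt g ((√(1 + 2 * t))⁻¹ ^ d) t := fun t ht => by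
    have ht0 : (0 : ℝ) < 1 + 2 * t := by have : (0 : ℝ) ≤ t := ht; linarith
    have h1 : HasDerivAt (fun t : ℝ => 1 + 2 * t) 2 t := by
      simpa using ((hasDerivAt_id t).const_mul 2).const_add 1
    have h2 := (h1.rpow_const (p := -(((d : ℝ) - 2) / 2)) (Or.inl ht0.ne')).const_mul
      (-(1 / ((d : ℝ) - 2)))
    convert! h2 using 1
    have e1 : (√(1 + 2 * t))⁻¹ ^ d = (1 + 2 * t) ^ (-((d : ℝ) / 2)) := by
      rw [Real.sqrt_eq_rpow, ← Real.rpow_neg ht0.le, ← Real.rpow_mul_natCast ht0.le]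
      congr 1; ring
    rw [e1, show -(((d : ℝ) - 2) / 2) - 1 = -((d : ℝ) / 2) by ring]
    field_simp
  have hlim : Tendsto g atTop (𝓝 0) := by
    have h1 : Tendsto (fun t : ℝ => 1 + 2 * t) atTop atTop :=
      tendsto_atTop_add_const_left _ _ (tendsto_id.const_mul_atTop two_pos)
    have h2 := ((tendsto_rpow_neg_atTop (half_pos hd')).comp h1).const_mul (-(1 / ((d : ℝ) - 2)))
    simpa [hg, Function.comp_def] using h2
  have hnn : ∀ t ∈ Set.Ioi (0 : ℝ), 0 ≤ (√(1 + 2 * t))⁻¹ ^ d := fun t _ => by positivity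
  rw [← ofReal_integral_eq_lintegral_ofReal (integrableOn_Ioi_deriv_of_nonneg' hder hnn hlim)
    ((ae_restrict_iff' measurableSet_Ioi).2 (ae_of_all _ hnn)),
    integral_Ioi_of_hasDerivAt_of_nonneg' hder hnn hlim]
  simp [hg]

/-- The mean of an inverse chi-squared variable with `d ≥ 3` degrees of freedom. The function
`1 / ‖x‖²` is written as `∫ exp (-t ‖x‖²) dt` over `t > 0`, which turns its mean into an integral of
the Laplace transform of `‖x‖²`. -/
lemma lintegral_inv_norm_sq_stdGaussian (hd : 3 ≤ Module.finrank ℝ E) :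
    ∫⁻ x, (ENNReal.ofReal (‖x‖ ^ 2))⁻¹ ∂(stdGaussian E)
      = ENNReal.ofReal (1 / ((Module.finrank ℝ E : ℝ) - 2)) := by
  simp_rw [← lintegral_exp_neg_mul_Ioi (sq_nonneg _)]
  rw [lintegral_lintegral_swap (by fun_prop), ← lintegral_inv_sqrt_pow_Ioi hd]
  refine setLIntegral_congr_fun measurableSet_Ioi fun t ht => ?_
  have ht0 : (0 : ℝ) ≤ t := le_of_lt ht

  rw [← ofReal_integral_eq_lintegral_ofReal ?_ (ae_of_all _ fun t => (Real.exp_pos _).le),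
    integral_exp_neg_mul_norm_sq_stdGaussian ht0]
  refine Integrable.of_bound (Measurable.aestronglyMeasurable (by fun_prop)) 1
    (ae_of_all _ fun x => ?_)
  rw [Real.norm_eq_abs, abs_of_pos (Real.exp_pos _), Real.exp_le_one_iff]
  nlinarith [sq_nonneg ‖x‖]

lemma map_orthogonalProjection_stdGaussian (K : Submodule ℝ E) :
    (stdGaussian E).map K.orthogonalProjectionOnto = stdGaussian K := by
  apply Measure.ext_of_charFun
  ext t
  rw [charFun_stdGaussian, charFun_apply, integral_map (by fun_prop) (by fun_prop)]
  have e : ∀ x : E, inner ℝ (K.orthogonalProjectionOnto x) t = inner ℝ x (t : E) := fun x => by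
    rw [Submodule.coe_inner, ← Submodule.starProjection_apply,
      Submodule.inner_starProjection_left_eq_right, Submodule.starProjection_eq_self_iff.2 t.2]
  simp_rw [e]
  rw [← charFun_apply, charFun_stdGaussian]
  simp

lemma lintegral_inv_norm_sq_orthogonalProjection (K : Submodule ℝ E)
    (hd : 3 ≤ Module.finrank ℝ K) :
    ∫⁻ x, (ENNReal.ofReal (‖K.orthogonalProjectionOnto x‖ ^ 2))⁻¹ ∂(stdGaussian E)
      = ENNReal.ofReal (1 / ((Module.finrank ℝ K : ℝ) - 2)) := by
  rw [← lintegral_inv_norm_sq_stdGaussian hd, ← map_orthogonalProjection_stdGaussian,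
    lintegral_map (by fun_prop) (by fun_prop)]

/-- The inverse squared length of the projection is almost surely finite because its mean is. -/
lemma ae_orthogonalProjection_ne_zero (K : Submodule ℝ E) (hd : 3 ≤ Module.finrank ℝ K) :
    ∀ᵐ x ∂(stdGaussian E), K.orthogonalProjectionOnto x ≠ 0 := by
  have h := ae_lt_top' (μ := stdGaussian E)
    (f := fun x => (ENNReal.ofReal (‖K.orthogonalProjectionOnto x‖ ^ 2))⁻¹) (by fun_prop)
    (by rw [lintegral_inv_norm_sq_orthogonalProjection K hd]; exact ENNReal.ofReal_ne_top)
  filter_upwards [h] with x hx h0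
  simp [h0] at hx

end

/-! ### Gram matrices and the mean of an inverse Wishart matrix -/

section

variable {E : Type*} [NormedAddCommGroup E] [InnerProductSpace ℝ E]

/-- A diagonal entry of an inverse Gram matrix is the inverse squared distance of the vector to the
span of the other vectors. -/
lemma inv_gram_apply_self {m : ℕ} [FiniteDimensional ℝ E] {z : Fin (m + 1) → E}
    (hz : LinearIndependent ℝ z) (j : Fin (m + 1)) :
    (Matrix.gram ℝ z)⁻¹ j j
      = (‖(Submodule.span ℝ (Set.range (j.removeNth z)))ᗮ.orthogonalProjectionOnto (z j)‖ ^ 2)⁻¹ := by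
  set K := (Submodule.span ℝ (Set.range (j.removeNth z)))ᗮ with hK
  have hdet : IsUnit (Matrix.gram ℝ z).det :=
    isUnit_iff_ne_zero.2 ((Matrix.det_gram_ne_zero_iff_linearIndependent).2 hz)
  set a : Fin (m + 1) → ℝ := fun k => (Matrix.gram ℝ z)⁻¹ k j with ha
  -- `u` is the element dual to `z j` in the span of the family.
  set u : E := ∑ k, a k • z k with hu
  have hzu : ∀ i, inner ℝ (z i) u = (1 : Matrix (Fin (m + 1)) (Fin (m + 1)) ℝ) i j := fun i => by
    rw [← Matrix.mul_nonsing_inv _ hdet, Matrix.mul_apply, hu, inner_sum]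
    exact Finset.sum_congr rfl fun k _ => by rw [inner_smul_right, Matrix.gram_apply, mul_comm]
  have huK : u ∈ K := by
    rw [hK, Submodule.mem_orthogonal]
    intro v hv
    induction hv using Submodule.span_induction with
    | mem x hx =>
      obtain ⟨i, rfl⟩ := hx
      simp [Fin.removeNth, hzu, Fin.succAbove_ne]
    | zero => simp
    | add x y _ _ hx hy => simp [inner_add_left, hx, hy]
    | smul c x _ hx => simp [inner_smul_left, hx]
  have hP : ∀ k, k ≠ j → K.starProjection (z k) = 0 := fun k hk => by
    rw [Submodule.starProjection_apply_eq_zero_iff, hK, Submodule.orthogonal_orthogonal]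
    obtain ⟨i, rfl⟩ := Fin.exists_succAbove_eq hk
    exact Submodule.subset_span ⟨i, rfl⟩
  have hPu : u = a j • K.starProjection (z j) := by
    rw [← Submodule.starProjection_eq_self_iff.2 huK, hu, map_sum,
      Finset.sum_eq_single j (fun k _ hk => by rw [map_smul, hP k hk, smul_zero]) (by simp),
      map_smul]
  have hnorm : ‖u‖ ^ 2 = a j := by
    rw [← real_inner_self_eq_norm_sq]
    conv_lhs => arg 2; rw [hu]
    rw [sum_inner, Finset.sum_eq_single j (fun k _ hk => ?_) (by simp)]
    · simp [real_inner_smul_left, hzu]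
    · simp [real_inner_smul_left, hzu, hk]
  have haj : a j ≠ 0 := fun h => by
    have h1 := hzu j
    rw [hPu, h] at h1
    simp at h1
  have hnP : ‖u‖ ^ 2 = a j ^ 2 * ‖K.orthogonalProjectionOnto (z j)‖ ^ 2 := by
    rw [hPu, norm_smul, mul_pow, Real.norm_eq_abs, sq_abs, Submodule.starProjection_apply,
      Submodule.coe_norm]
  rw [hnorm] at hnP
  refine eq_inv_of_mul_eq_one_left (mul_left_cancel₀ haj ?_)
  rw [mul_one, ← mul_assoc, ← sq]
  exact hnP.symm

lemma finrank_orthogonal_span_add [FiniteDimensional ℝ E] {m : ℕ} {z : Fin m → E}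
    (hz : LinearIndependent ℝ z) :
    Module.finrank ℝ (Submodule.span ℝ (Set.range z))ᗮ + m = Module.finrank ℝ E := by
  rw [← Submodule.finrank_add_finrank_orthogonal (Submodule.span ℝ (Set.range z)),
    finrank_span_eq_card hz, Fintype.card_fin, add_comm]

lemma continuous_gram {m : ℕ} : Continuous fun z : Fin m → E => Matrix.gram ℝ z :=
  continuous_pi fun _ => continuous_pi fun _ => by
    simp only [Matrix.gram_apply]
    fun_prop

variable [FiniteDimensional ℝ E] [MeasurableSpace E] [BorelSpace E]

lemma measurable_inv_gram_apply {m : ℕ} (j k : Fin m) :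
    Measurable fun z : Fin m → E => (Matrix.gram ℝ z)⁻¹ j k := by
  simp only [Matrix.inv_def, Matrix.smul_apply, Ring.inverse_eq_inv', smul_eq_mul]
  exact (continuous_gram.matrix_det.measurable.inv).mul
    ((continuous_gram.matrix_adjugate.matrix_elem j k).measurable)

lemma measurableSet_linearIndependent {m : ℕ} :
    MeasurableSet {z : Fin m → E | LinearIndependent ℝ z} := by
  simp_rw [← Matrix.det_gram_ne_zero_iff_linearIndependent (𝕜 := ℝ)]
  exact (continuous_gram.matrix_det.measurable (measurableSet_singleton 0)).compl

lemma measurePreserving_insertNth_stdGaussian {m : ℕ} (j : Fin (m + 1)) :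
    MeasurePreserving (fun q : E × (Fin m → E) => (j.insertNth q.1 q.2 : Fin (m + 1) → E))
      ((stdGaussian E).prod (Measure.pi fun _ => stdGaussian E))
      (Measure.pi fun _ => stdGaussian E) :=
  (measurePreserving_piFinSuccAbove (fun _ : Fin (m + 1) => stdGaussian E) j).symm _

lemma ae_linearIndependent_insertNth_iff {m : ℕ} (j : Fin (m + 1)) :
    (∀ᵐ z ∂(Measure.pi fun _ : Fin (m + 1) => stdGaussian E), LinearIndependent ℝ z) ↔
      ∀ᵐ w ∂(Measure.pi fun _ : Fin m => stdGaussian E), ∀ᵐ x ∂(stdGaussian E),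
        LinearIndependent ℝ (j.insertNth x w : Fin (m + 1) → E) := by
  have hmp := measurePreserving_insertNth_stdGaussian (E := E) j
  have hms : MeasurableSet {q : E × (Fin m → E) |
      LinearIndependent ℝ (j.insertNth q.1 q.2 : Fin (m + 1) → E)} :=
    hmp.measurable measurableSet_linearIndependent
  rw [← hmp.map_eq, ae_map_iff hmp.measurable.aemeasurable measurableSet_linearIndependent,
    Measure.ae_prod_iff_ae_ae hms]
  exact Measure.ae_ae_comm hms

/-- Induction on the number of vectors. The bound on `m` leaves an orthogonal complement of dimension
at least three at each step, as `ae_orthogonalProjection_ne_zero` requires. -/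
lemma ae_linearIndependent_stdGaussian {m : ℕ} (hm : m + 2 ≤ Module.finrank ℝ E) :
    ∀ᵐ z ∂(Measure.pi fun _ : Fin m => stdGaussian E), LinearIndependent ℝ z := by
  induction m with
  | zero => exact ae_of_all _ fun z => linearIndependent_empty_type
  | succ m ih =>
    rw [ae_linearIndependent_insertNth_iff 0]
    filter_upwards [ih (by omega)] with w hw
    have hfr := finrank_orthogonal_span_add hw
    filter_upwards [ae_orthogonalProjection_ne_zero (Submodule.span ℝ (Set.range w))ᗮ
      (by omega)] with x hx
    rw [Fin.insertNth_zero', linearIndependent_finCons]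
    refine ⟨hw, fun hxw => hx ?_⟩
    rw [Submodule.orthogonalProjectionOnto_eq_zero_iff, Submodule.orthogonal_orthogonal]
    exact hxw

/-- The mean of a diagonal entry of the inverse of a standard Wishart matrix. Conditionally on the
other vectors, the distance of a Gaussian vector to their span is the length of a standard Gaussian
vector of the orthogonal complement. -/
lemma lintegral_inv_gram_apply_self {m : ℕ} (hm : m + 2 ≤ Module.finrank ℝ E) (j : Fin m) :
    ∫⁻ z, ENNReal.ofReal ((Matrix.gram ℝ z)⁻¹ j j)
        ∂(Measure.pi fun _ : Fin m => stdGaussian E)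
      = ENNReal.ofReal (1 / ((Module.finrank ℝ E : ℝ) - m - 1)) := by
  obtain ⟨m, rfl⟩ : ∃ k, m = k + 1 := ⟨m - 1, by have := j.2; omega⟩
  have hmp := measurePreserving_insertNth_stdGaussian (E := E) j
  have hmeas : Measurable fun z : Fin (m + 1) → E =>
      ENNReal.ofReal ((Matrix.gram ℝ z)⁻¹ j j) :=
    (measurable_inv_gram_apply j j).ennreal_ofReal
  have hae := (ae_linearIndependent_insertNth_iff j).1
    (ae_linearIndependent_stdGaussian (E := E) hm)
  rw [← hmp.lintegral_comp hmeas]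
  refine (lintegral_prod_symm' _ (hmeas.comp hmp.measurable)).trans ?_
  have h2 : ∀ᵐ w ∂(Measure.pi fun _ : Fin m => stdGaussian E),
      ∫⁻ x, ENNReal.ofReal ((Matrix.gram ℝ (j.insertNth x w : Fin (m + 1) → E))⁻¹ j j)
          ∂(stdGaussian E)
        = ENNReal.ofReal (1 / ((Module.finrank ℝ E : ℝ) - (m + 1 : ℕ) - 1)) := by
    filter_upwards [hae, ae_linearIndependent_stdGaussian (E := E) (m := m) (by omega)]
      with w hw hw'
    have hfr := finrank_orthogonal_span_add hw'
    have hfr' : (Module.finrank ℝ (Submodule.span ℝ (Set.range w))ᗮ : ℝ) + m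
      = Module.finrank ℝ E := by exact_mod_cast hfr
    rw [show (Module.finrank ℝ E : ℝ) - (m + 1 : ℕ) - 1
      = (Module.finrank ℝ (Submodule.span ℝ (Set.range w))ᗮ : ℝ) - 2 by push_cast; linarith,
      ← lintegral_inv_norm_sq_orthogonalProjection (Submodule.span ℝ (Set.range w))ᗮ (by omega)]
    refine lintegral_congr_ae ?_
    filter_upwards [hw, ae_orthogonalProjection_ne_zero (Submodule.span ℝ (Set.range w))ᗮ
        (by omega)] with x hx hx0
    have := norm_pos_iff.2 hx0
    rw [inv_gram_apply_self hx j, Fin.insertNth_apply_same, Fin.removeNth_insertNth,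
      ENNReal.ofReal_inv_of_pos (by positivity)]
  refine (lintegral_congr_ae h2).trans ?_
  simp

end

/-! ### Second moments of a Wishart matrix -/

/-- The variance of the square of a standard normal variable. Only its finiteness matters. -/
noncomputable def gaussianSqVariance : ℝ := Var[fun x => x ^ 2; gaussianReal 0 1]

section

variable {F : Type*} [NormedAddCommGroup F] [InnerProductSpace ℝ F] {p : ℕ}

/-- The deviation of a normalized standard Wishart matrix from the identity. -/
noncomputable def wishartDeviation (N : ℝ) (w : Fin p → F) : Matrix (Fin p) (Fin p) ℝ :=
  N⁻¹ • Matrix.gram ℝ w - 1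

lemma wishartDeviation_apply (N : ℝ) (w : Fin p → F) (j k : Fin p) :
    wishartDeviation N w j k
      = N⁻¹ * inner ℝ (w j) (w k) - (1 : Matrix (Fin p) (Fin p) ℝ) j k := rfl

end

section

variable {F : Type*} [NormedAddCommGroup F] [InnerProductSpace ℝ F] [FiniteDimensional ℝ F]
  [MeasurableSpace F] [BorelSpace F]

lemma memLp_four_norm_stdGaussian : MemLp (fun x : F => ‖x‖) 4 (stdGaussian F) :=
  (IsGaussian.memLp_id (stdGaussian F) 4 (by norm_num)).norm

lemma holderTriple_four : ENNReal.HolderTriple 4 4 2 := by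
  refine ⟨?_⟩
  rw [← ENNReal.toReal_eq_toReal_iff' (by simp) (by simp), ENNReal.toReal_add (by simp) (by simp)]
  norm_num

lemma memLp_two_norm_sq_stdGaussian : MemLp (fun x : F => ‖x‖ ^ 2) 2 (stdGaussian F) := by
  have := holderTriple_four
  simp_rw [sq]
  exact memLp_four_norm_stdGaussian.mul' memLp_four_norm_stdGaussian

lemma integral_inner_sq_stdGaussian (v : F) :
    ∫ x, inner ℝ x v ^ 2 ∂(stdGaussian F) = ‖v‖ ^ 2 := by
  have h := variance_dual_stdGaussian (innerSL ℝ v)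
  rw [variance_eq_sub (IsGaussian.memLp_dual (stdGaussian F) (innerSL ℝ v) 2 (by simp)),
    integral_strongDual_stdGaussian] at h
  simpa [real_inner_comm] using h

lemma map_norm_sq_stdGaussian :
    (stdGaussian F).map (fun x => ‖x‖ ^ 2)
      = (Measure.pi fun _ : Fin (Module.finrank ℝ F) => gaussianReal 0 1).map
          (∑ i, fun x => x i ^ 2) := by
  rw [stdGaussian, Measure.map_map (by fun_prop) (by fun_prop)]
  congr 1
  ext x
  rw [Function.comp_apply, ← real_inner_self_eq_norm_sq,
    (stdOrthonormalBasis ℝ F).orthonormal.inner_sum]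
  simp [sq]

lemma memLp_sq_gaussianReal : MemLp (fun x : ℝ => x ^ 2) 2 (gaussianReal 0 1) := by
  have := holderTriple_four
  simp_rw [sq]
  exact (memLp_id_gaussianReal' 4 (by norm_num)).mul' (memLp_id_gaussianReal' 4 (by norm_num))

lemma integral_norm_sq_stdGaussian :
    ∫ x, ‖x‖ ^ 2 ∂(stdGaussian F) = Module.finrank ℝ F := by
  have e : ∀ x : F, ‖x‖ ^ 2 = ∑ i, inner ℝ x (stdOrthonormalBasis ℝ F i) ^ 2 := fun x =>
    ((stdOrthonormalBasis ℝ F).sum_sq_inner_left x).symm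
  simp_rw [e]
  rw [integral_finsetSum]
  · simp [integral_inner_sq_stdGaussian]
  · intro i _
    refine MemLp.integrable_sq ?_
    simpa [real_inner_comm] using
      IsGaussian.memLp_dual (stdGaussian F) (innerSL ℝ (stdOrthonormalBasis ℝ F i)) 2 (by simp)

lemma variance_norm_sq_stdGaussian :
    Var[fun x => ‖x‖ ^ 2; stdGaussian F] = Module.finrank ℝ F * gaussianSqVariance := by
  have h1 : Var[id; (stdGaussian F).map (fun x => ‖x‖ ^ 2)]
      = Var[fun x => ‖x‖ ^ 2; stdGaussian F] := by
    rw [variance_map aemeasurable_id (by fun_prop)]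
    rfl
  rw [← h1, map_norm_sq_stdGaussian, variance_map aemeasurable_id
    (by rw [Finset.sum_fn]; exact Measurable.aemeasurable (by fun_prop)), Function.id_comp,
    variance_sum_pi fun _ => memLp_sq_gaussianReal]
  simp [gaussianSqVariance]

lemma integral_norm_sq_div_sub_one_sq (N : ℝ) :
    ∫ x, (‖x‖ ^ 2 / N - 1) ^ 2 ∂(stdGaussian F)
      = Module.finrank ℝ F * gaussianSqVariance / N ^ 2 + (Module.finrank ℝ F / N - 1) ^ 2 := by
  have hm : MemLp (fun x : F => ‖x‖ ^ 2 / N - 1) 2 (stdGaussian F) := by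
    simp_rw [div_eq_inv_mul]
    exact (memLp_two_norm_sq_stdGaussian.const_mul N⁻¹).sub (memLp_const 1)
  have h := variance_eq_sub hm
  have hi : ∫ x : F, (‖x‖ ^ 2 / N - 1) ∂(stdGaussian F) = Module.finrank ℝ F / N - 1 := by
    rw [integral_sub ((memLp_two_norm_sq_stdGaussian.integrable one_le_two).div_const N)
      (integrable_const _), integral_div, integral_norm_sq_stdGaussian]
    simp
  have hv : Var[fun x : F => ‖x‖ ^ 2 / N - 1; stdGaussian F]
      = Module.finrank ℝ F * gaussianSqVariance / N ^ 2 := by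
    simp_rw [div_eq_inv_mul, sub_eq_add_neg]
    rw [variance_add_const (by fun_prop), variance_const_mul, variance_norm_sq_stdGaussian]
    ring
  rw [hv, hi] at h
  simp only [Pi.pow_apply] at h
  linarith

variable {p : ℕ}

lemma memLp_inner_stdGaussian (j k : Fin p) :
    MemLp (fun w : Fin p → F => inner ℝ (w j) (w k)) 2
      (Measure.pi fun _ => stdGaussian F) := by
  have := holderTriple_four
  have h : ∀ i, MemLp (fun w : Fin p → F => ‖w i‖) 4 (Measure.pi fun _ => stdGaussian F) :=
    fun i => memLp_four_norm_stdGaussian.comp_measurePreserving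
      (measurePreserving_eval (fun _ : Fin p => stdGaussian F) i)
  refine MemLp.mono' ((h k).mul' (h j)) (Measurable.aestronglyMeasurable (by fun_prop))
    (ae_of_all _ fun w => ?_)
  exact abs_real_inner_le_norm _ _

lemma integral_inner_sq_of_ne {j k : Fin p} (hjk : j ≠ k) :
    ∫ w, inner ℝ (w j) (w k) ^ 2 ∂(Measure.pi fun _ : Fin p => stdGaussian F)
      = Module.finrank ℝ F := by
  have hind := (iIndepFun_pi (μ := fun _ : Fin p => stdGaussian F) (X := fun _ => id)
    fun _ => aemeasurable_id).indepFun hjk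
  have hmap := (indepFun_iff_map_prod_eq_prod_map_map
    (Measurable.aemeasurable (by fun_prop)) (Measurable.aemeasurable (by fun_prop))).1 hind
  simp only [id_eq] at hmap
  rw [(measurePreserving_eval (fun _ : Fin p => stdGaussian F) j).map_eq,
    (measurePreserving_eval (fun _ : Fin p => stdGaussian F) k).map_eq] at hmap
  have hint := (memLp_inner_stdGaussian (F := F) j k).integrable_sq
  have hint' : Integrable (fun q : F × F => inner ℝ q.1 q.2 ^ 2)
      ((stdGaussian F).prod (stdGaussian F)) := by
    rw [← hmap, integrable_map_measure (by fun_prop) (by fun_prop)]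
    exact hint
  have h1 : ∫ w, inner ℝ (w j) (w k) ^ 2 ∂(Measure.pi fun _ : Fin p => stdGaussian F)
      = ∫ q : F × F, inner ℝ q.1 q.2 ^ 2 ∂((stdGaussian F).prod (stdGaussian F)) := by
    rw [← hmap, integral_map (by fun_prop) (by fun_prop)]
  rw [h1, integral_prod_symm _ hint']
  simp [integral_inner_sq_stdGaussian, integral_norm_sq_stdGaussian]

lemma memLp_wishartDeviation (N : ℝ) (j k : Fin p) :
    MemLp (fun w : Fin p → F => wishartDeviation N w j k) 2
      (Measure.pi fun _ => stdGaussian F) :=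
  ((memLp_inner_stdGaussian j k).const_mul N⁻¹).sub (memLp_const _)

lemma measurePreserving_neg_stdGaussian (i : Fin p) :
    MeasurePreserving (fun (w : Fin p → F) k => if k = i then -w k else w k)
      (Measure.pi fun _ => stdGaussian F) (Measure.pi fun _ => stdGaussian F) := by
  refine measurePreserving_pi (f := fun k x => if k = i then -x else x) _ _ fun k => ?_
  by_cases hk : k = i
  · simp only [hk, if_true]
    exact ⟨by fun_prop, stdGaussian_map (LinearIsometryEquiv.neg ℝ)⟩
  · simp only [hk, if_false]
    exact MeasurePreserving.id _

lemma integral_wishartDeviation_mul_of_ne (N : ℝ) (k : Fin p) {j l : Fin p} (hjl : j ≠ l) :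
    ∫ w, wishartDeviation N w k j * wishartDeviation N w k l
      ∂(Measure.pi fun _ : Fin p => stdGaussian F) = 0 := by
  -- One of the indices `j`, `l` differs from `k`; flipping that vector changes exactly one factor.
  wlog hjk : j ≠ k generalizing j l
  · rw [not_not] at hjk
    have := this hjl.symm (by rw [← hjk]; exact hjl.symm)
    simpa [mul_comm] using this
  have hmp := measurePreserving_neg_stdGaussian (F := F) j
  have h1 : ∫ w, wishartDeviation N w k j * wishartDeviation N w k l
      ∂(Measure.pi fun _ : Fin p => stdGaussian F)
      = ∫ w, -(wishartDeviation N w k j * wishartDeviation N w k l)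
      ∂(Measure.pi fun _ : Fin p => stdGaussian F) := by
    conv_lhs => rw [← hmp.map_eq]
    rw [integral_map hmp.measurable.aemeasurable]
    · refine integral_congr_ae (ae_of_all _ fun w => ?_)
      simp [wishartDeviation_apply, hjl.symm, hjk.symm, Matrix.one_apply]
    · simp_rw [wishartDeviation_apply]
      exact Measurable.aestronglyMeasurable (by fun_prop)
  rw [integral_neg] at h1
  linarith

/-- The factor by which the squared deviation of a normalized Wishart matrix of dimension `p` with
`d` degrees of freedom is a multiple of the identity in the mean. -/
noncomputable def deviationFactor (d p : ℕ) (N : ℝ) : ℝ :=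
  d * gaussianSqVariance / N ^ 2 + (d / N - 1) ^ 2 + ((p : ℝ) - 1) * (d / N ^ 2)

lemma integral_wishartDeviation_sq (N : ℝ) (k j : Fin p) :
    ∫ w, wishartDeviation N w k j * wishartDeviation N w k j
        ∂(Measure.pi fun _ : Fin p => stdGaussian F)
      = if k = j then Module.finrank ℝ F * gaussianSqVariance / N ^ 2
          + (Module.finrank ℝ F / N - 1) ^ 2 else Module.finrank ℝ F / N ^ 2 := by
  simp_rw [wishartDeviation_apply]
  split_ifs with h
  · subst h
    have hmp := measurePreserving_eval (fun _ : Fin p => stdGaussian F) k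
    have h1 := integral_map (μ := Measure.pi fun _ : Fin p => stdGaussian F)
      (f := fun x : F => (‖x‖ ^ 2 / N - 1) ^ 2)
      hmp.measurable.aemeasurable (Measurable.aestronglyMeasurable (by fun_prop))
    rw [hmp.map_eq, integral_norm_sq_div_sub_one_sq] at h1
    rw [h1]
    refine integral_congr_ae (ae_of_all _ fun w => ?_)
    simp only [real_inner_self_eq_norm_sq, Matrix.one_apply_eq, Function.eval]
    ring
  · simp only [Matrix.one_apply_ne h, sub_zero]
    rw [← integral_inner_sq_of_ne (F := F) h, ← integral_div]
    refine integral_congr_ae (ae_of_all _ fun w => ?_)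
    simp only
    ring

lemma mulVec_sq_sum_eq (A : Matrix (Fin p) (Fin p) ℝ) (b : Fin p → ℝ) :
    ∑ k, (A *ᵥ b) k ^ 2 = ∑ k, ∑ j, ∑ l, A k j * A k l * (b j * b l) := by
  refine Finset.sum_congr rfl fun k _ => ?_
  rw [sq, Matrix.mulVec, dotProduct, Finset.sum_mul_sum]
  exact Finset.sum_congr rfl fun j _ => Finset.sum_congr rfl fun l _ => by ring

lemma integrable_wishartDeviation_mulVec (N : ℝ) (b : Fin p → ℝ) :
    Integrable (fun w : Fin p → F => ∑ k, (wishartDeviation N w *ᵥ b) k ^ 2)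
      (Measure.pi fun _ => stdGaussian F) := by
  simp_rw [mulVec_sq_sum_eq]
  refine integrable_finsetSum _ fun k _ => integrable_finsetSum _ fun j _ =>
    integrable_finsetSum _ fun l _ => Integrable.mul_const ?_ _
  exact (memLp_wishartDeviation N k j).integrable_mul (memLp_wishartDeviation N k l)

lemma integral_wishartDeviation_mulVec (N : ℝ) (b : Fin p → ℝ) :
    ∫ w, ∑ k, (wishartDeviation N w *ᵥ b) k ^ 2 ∂(Measure.pi fun _ : Fin p => stdGaussian F)
      = deviationFactor (Module.finrank ℝ F) p N * ∑ j, b j ^ 2 := by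
  simp_rw [mulVec_sq_sum_eq]
  have hint : ∀ k j l : Fin p, Integrable (fun w : Fin p → F =>
      wishartDeviation N w k j * wishartDeviation N w k l * (b j * b l))
      (Measure.pi fun _ => stdGaussian F) := fun k j l =>
    ((memLp_wishartDeviation N k j).integrable_mul (memLp_wishartDeviation N k l)).mul_const _
  rw [integral_finsetSum _ fun k _ => integrable_finsetSum _ fun j _ =>
    integrable_finsetSum _ fun l _ => hint k j l]
  have hk : ∀ k : Fin p, ∫ w, ∑ j, ∑ l,
      wishartDeviation N w k j * wishartDeviation N w k l * (b j * b l)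
        ∂(Measure.pi fun _ : Fin p => stdGaussian F)
      = ∑ j, (if k = j then Module.finrank ℝ F * gaussianSqVariance / N ^ 2
          + (Module.finrank ℝ F / N - 1) ^ 2 else Module.finrank ℝ F / N ^ 2) * b j ^ 2 := by
    intro k
    rw [integral_finsetSum _ fun j _ => integrable_finsetSum _ fun l _ => hint k j l]
    refine Finset.sum_congr rfl fun j _ => ?_
    rw [integral_finsetSum _ fun l _ => hint k j l, Finset.sum_eq_single j]
    · rw [integral_mul_const, integral_wishartDeviation_sq, sq (b j)]
    · intro l _ hl
      rw [integral_mul_const, integral_wishartDeviation_mul_of_ne N k hl.symm, zero_mul]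
    · simp
  simp_rw [hk]
  rw [Finset.sum_comm, Finset.mul_sum]
  refine Finset.sum_congr rfl fun j _ => ?_
  rw [← Finset.sum_mul]
  congr 1
  have e : ∀ k : Fin p, (if k = j then Module.finrank ℝ F * gaussianSqVariance / N ^ 2
      + (Module.finrank ℝ F / N - 1) ^ 2 else (Module.finrank ℝ F : ℝ) / N ^ 2)
      = (if k = j then Module.finrank ℝ F * gaussianSqVariance / N ^ 2
      + (Module.finrank ℝ F / N - 1) ^ 2 - (Module.finrank ℝ F : ℝ) / N ^ 2 else 0)
      + (Module.finrank ℝ F : ℝ) / N ^ 2 := fun k => by split_ifs <;> ring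
  simp_rw [e, Finset.sum_add_distrib]
  simp [deviationFactor]
  ring

lemma integrable_sum_norm_sq :
    Integrable (fun w : Fin p → F => ∑ j, ‖w j‖ ^ 2) (Measure.pi fun _ => stdGaussian F) := by
  refine integrable_finsetSum _ fun j _ => ?_
  simp_rw [← real_inner_self_eq_norm_sq]
  exact (memLp_inner_stdGaussian j j).integrable one_le_two

lemma integral_sum_norm_sq :
    ∫ w, ∑ j, ‖w j‖ ^ 2 ∂(Measure.pi fun _ : Fin p => stdGaussian F)
      = p * Module.finrank ℝ F := by
  have h : ∀ j : Fin p, ∫ w, ‖w j‖ ^ 2 ∂(Measure.pi fun _ : Fin p => stdGaussian F)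
      = Module.finrank ℝ F := fun j => by
    have hmp := measurePreserving_eval (fun _ : Fin p => stdGaussian F) j
    have h1 := integral_map (μ := Measure.pi fun _ : Fin p => stdGaussian F)
      (f := fun x : F => ‖x‖ ^ 2)
      hmp.measurable.aemeasurable (Measurable.aestronglyMeasurable (by fun_prop))
    rw [hmp.map_eq, integral_norm_sq_stdGaussian] at h1
    exact h1.symm
  rw [integral_finsetSum]
  · simp [h]
  · intro j _
    simp_rw [← real_inner_self_eq_norm_sq]
    exact (memLp_inner_stdGaussian j j).integrable one_le_two

end

/-! ### The risk in whitened coordinates -/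

section

variable {E : Type*} [NormedAddCommGroup E] [InnerProductSpace ℝ E] {p : ℕ}

/-- The squared length of the projection of `e` to the span of the linearly independent family `z`,
in terms of the Gram matrix of `z`. -/
noncomputable def spanLeverage (e : E) (z : Fin p → E) : ℝ :=
  (fun j => inner ℝ (z j) e) ⬝ᵥ ((Matrix.gram ℝ z)⁻¹ *ᵥ fun j => inner ℝ (z j) e)

lemma spanLeverage_nonneg (e : E) (z : Fin p → E) : 0 ≤ spanLeverage e z := by
  simpa [spanLeverage] using (Matrix.posSemidef_gram ℝ z).inv.dotProduct_mulVec_nonneg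
    (fun j => inner ℝ (z j) e)

lemma spanLeverage_eq_sum (e : E) (z : Fin p → E) :
    spanLeverage e z
      = ∑ j, ∑ k, (Matrix.gram ℝ z)⁻¹ j k * (inner ℝ (z j) e * inner ℝ (z k) e) := by
  simp only [spanLeverage, dotProduct, Matrix.mulVec, Finset.mul_sum]
  exact Finset.sum_congr rfl fun j _ => Finset.sum_congr rfl fun k _ => by ring

lemma spanLeverage_map (f : E ≃ₗᵢ[ℝ] E) (e : E) (z : Fin p → E) :
    spanLeverage (f e) (fun j => f (z j)) = spanLeverage e z := by
  have : Matrix.gram ℝ (fun j => f (z j)) = Matrix.gram ℝ z := by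
    ext j k
    simp [Matrix.gram_apply]
  simp [spanLeverage, this]

lemma sum_spanLeverage {ι : Type*} [Fintype ι] (b : OrthonormalBasis ι ℝ E) {z : Fin p → E}
    (hz : LinearIndependent ℝ z) : ∑ i, spanLeverage (b i) z = p := by
  have hdet : IsUnit (Matrix.gram ℝ z).det :=
    isUnit_iff_ne_zero.2 ((Matrix.det_gram_ne_zero_iff_linearIndependent).2 hz)
  have h : ∑ i, spanLeverage (b i) z = ((Matrix.gram ℝ z)⁻¹ * Matrix.gram ℝ z).trace := by
    simp_rw [spanLeverage_eq_sum]
    rw [Finset.sum_comm, Matrix.trace]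
    refine Finset.sum_congr rfl fun j _ => ?_
    rw [Finset.sum_comm, Matrix.diag_apply, Matrix.mul_apply]
    refine Finset.sum_congr rfl fun k _ => ?_
    rw [← Finset.mul_sum, Matrix.gram_apply, ← b.sum_inner_mul_inner]
    congr 1
    exact Finset.sum_congr rfl fun i _ => by rw [mul_comm, real_inner_comm (b i) (z j)]
  rw [h, Matrix.nonsing_inv_mul _ hdet]
  simp

variable [FiniteDimensional ℝ E] [MeasurableSpace E] [BorelSpace E]

lemma measurable_spanLeverage (e : E) : Measurable (spanLeverage e : (Fin p → E) → ℝ) := by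
  have : (spanLeverage e : (Fin p → E) → ℝ) = fun z => _ := funext (spanLeverage_eq_sum e)
  rw [this]
  exact Finset.measurable_sum _ fun j _ => Finset.measurable_sum _ fun k _ =>
    (measurable_inv_gram_apply j k).mul (by fun_prop)

lemma lintegral_spanLeverage_congr {e e' : E} (h : ‖e‖ = ‖e'‖) :
    ∫⁻ z, ENNReal.ofReal (spanLeverage e z) ∂(Measure.pi fun _ : Fin p => stdGaussian E)
      = ∫⁻ z, ENNReal.ofReal (spanLeverage e' z)
        ∂(Measure.pi fun _ : Fin p => stdGaussian E) := by
  set f := (ℝ ∙ (e - e'))ᗮ.reflection with hf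
  have hfe : f e = e' := Submodule.reflection_sub h
  have hmp : MeasurePreserving (fun (z : Fin p → E) j => f (z j))
      (Measure.pi fun _ => stdGaussian E) (Measure.pi fun _ => stdGaussian E) :=
    measurePreserving_pi _ _ fun _ => ⟨by fun_prop, stdGaussian_map f⟩
  rw [← hmp.lintegral_comp (measurable_spanLeverage e').ennreal_ofReal]
  simp_rw [← hfe, spanLeverage_map]

/-- By rotation invariance, the mean squared length of the projection of a unit vector to the span
of a Gaussian family does not depend on the vector, and these lengths add up to `p` over an
orthonormal basis. -/
lemma lintegral_spanLeverage (hp : p + 2 ≤ Module.finrank ℝ E) {e : E} (he : ‖e‖ = 1) :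
    ∫⁻ z, ENNReal.ofReal (spanLeverage e z) ∂(Measure.pi fun _ : Fin p => stdGaussian E)
      = ENNReal.ofReal (p / Module.finrank ℝ E) := by
  have hN : (0 : ℝ) < Module.finrank ℝ E := by
    have : 0 < Module.finrank ℝ E := by omega
    exact_mod_cast this
  set b := stdOrthonormalBasis ℝ E
  have h1 : ∑ i, ∫⁻ z, ENNReal.ofReal (spanLeverage (b i) z)
      ∂(Measure.pi fun _ : Fin p => stdGaussian E) = ENNReal.ofReal p := by
    rw [← lintegral_finsetSum _ fun i _ => (measurable_spanLeverage (b i)).ennreal_ofReal]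
    have h2 : ∀ᵐ z ∂(Measure.pi fun _ : Fin p => stdGaussian E),
        ∑ i, ENNReal.ofReal (spanLeverage (b i) z) = ENNReal.ofReal p := by
      filter_upwards [ae_linearIndependent_stdGaussian hp] with z hz
      rw [← ENNReal.ofReal_sum_of_nonneg fun i _ => spanLeverage_nonneg _ _, sum_spanLeverage b hz]
    rw [lintegral_congr_ae h2]
    simp
  have h3 : ∀ i, ∫⁻ z, ENNReal.ofReal (spanLeverage (b i) z)
      ∂(Measure.pi fun _ : Fin p => stdGaussian E)
      = ∫⁻ z, ENNReal.ofReal (spanLeverage e z)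
        ∂(Measure.pi fun _ : Fin p => stdGaussian E) := fun i =>
    lintegral_spanLeverage_congr (by rw [he, b.orthonormal.1 i])
  simp_rw [h3] at h1
  rw [Finset.sum_const, Finset.card_univ, Fintype.card_fin, nsmul_eq_mul] at h1
  rw [ENNReal.ofReal_div_of_pos hN, ENNReal.eq_div_iff, ENNReal.ofReal_natCast, h1]
  · simpa using hN.ne'
  · simp

/-- A nonnegative function with lower Lebesgue integral `ofReal c` has integral `c`. -/
lemma integrable_and_integral_eq_of_lintegral_eq {Ω : Type*} [MeasurableSpace Ω] {μ : Measure Ω}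
    {f : Ω → ℝ} {c : ℝ} (hf : Measurable f) (h0 : ∀ x, 0 ≤ f x) (hc : 0 ≤ c)
    (h : ∫⁻ x, ENNReal.ofReal (f x) ∂μ = ENNReal.ofReal c) :
    Integrable f μ ∧ ∫ x, f x ∂μ = c := by
  constructor
  · refine ⟨hf.aestronglyMeasurable, ?_⟩
    rw [hasFiniteIntegral_iff_ofReal (ae_of_all _ h0), h]
    exact ENNReal.ofReal_lt_top
  · rw [integral_eq_lintegral_of_nonneg_ae (ae_of_all _ h0) hf.aestronglyMeasurable, h,
      ENNReal.toReal_ofReal hc]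

lemma integral_spanLeverage (hp : p + 2 ≤ Module.finrank ℝ E) {e : E} (he : ‖e‖ = 1) :
    Integrable (spanLeverage e) (Measure.pi fun _ : Fin p => stdGaussian E) ∧
    ∫ z, spanLeverage e z ∂(Measure.pi fun _ : Fin p => stdGaussian E)
      = p / Module.finrank ℝ E :=
  integrable_and_integral_eq_of_lintegral_eq (measurable_spanLeverage e)
    (spanLeverage_nonneg e) (by positivity) (lintegral_spanLeverage hp he)

lemma integral_trace_inv_gram (hp : p + 2 ≤ Module.finrank ℝ E) :
    Integrable (fun z => (Matrix.gram ℝ z)⁻¹.trace)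
      (Measure.pi fun _ : Fin p => stdGaussian E) ∧
    ∫ z, (Matrix.gram ℝ z)⁻¹.trace ∂(Measure.pi fun _ : Fin p => stdGaussian E)
      = p / ((Module.finrank ℝ E : ℝ) - p - 1) := by
  have hN : (p : ℝ) + 2 ≤ Module.finrank ℝ E := by exact_mod_cast hp
  have h : ∀ j, _ := fun j => integrable_and_integral_eq_of_lintegral_eq
    (measurable_inv_gram_apply (E := E) j j)
    (fun z => (Matrix.posSemidef_gram ℝ z).inv.diag_nonneg) (by
      apply one_div_nonneg.2; linarith) (lintegral_inv_gram_apply_self hp j)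
  simp only [Matrix.trace, Matrix.diag_apply]
  refine ⟨integrable_finsetSum _ fun j _ => (h j).1, ?_⟩
  rw [integral_finsetSum _ fun j _ => (h j).1]
  simp only [(h _).2]
  simp [div_eq_mul_inv]

lemma measurePreserving_orthogonalProjection_stdGaussian (K : Submodule ℝ E) :
    MeasurePreserving (fun (z : Fin p → E) j => K.orthogonalProjectionOnto (z j))
      (Measure.pi fun _ => stdGaussian E) (Measure.pi fun _ => stdGaussian K) :=
  measurePreserving_pi _ _ fun _ => ⟨by fun_prop, map_orthogonalProjection_stdGaussian K⟩

lemma integral_orthogonalProjection {K : Submodule ℝ E} {f : (Fin p → K) → ℝ}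
    (hf : Integrable f (Measure.pi fun _ => stdGaussian K)) :
    Integrable (fun z : Fin p → E => f fun j => K.orthogonalProjectionOnto (z j))
      (Measure.pi fun _ => stdGaussian E) ∧
    ∫ z : Fin p → E, f (fun j => K.orthogonalProjectionOnto (z j))
        ∂(Measure.pi fun _ => stdGaussian E)
      = ∫ w, f w ∂(Measure.pi fun _ => stdGaussian K) := by
  have hmp := measurePreserving_orthogonalProjection_stdGaussian (p := p) K
  refine ⟨hmp.integrable_comp_of_integrable hf, ?_⟩
  rw [← hmp.map_eq, integral_map hmp.measurable.aemeasurable]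
  rw [hmp.map_eq]
  exact hf.aestronglyMeasurable

lemma integral_affine_comb {Ω : Type*} [MeasurableSpace Ω] {μ : Measure Ω}
    [IsProbabilityMeasure μ] {f₁ f₂ f₃ f₄ : Ω → ℝ} (h₁ : Integrable f₁ μ) (h₂ : Integrable f₂ μ)
    (h₃ : Integrable f₃ μ) (h₄ : Integrable f₄ μ) (a₁ a₂ a₃ a₄ s t : ℝ) :
    Integrable (fun x => a₁ * f₁ x + s * (a₂ * f₂ x + a₃ * (t - f₃ x) + a₄ * f₄ x)) μ ∧
    ∫ x, (a₁ * f₁ x + s * (a₂ * f₂ x + a₃ * (t - f₃ x) + a₄ * f₄ x)) ∂μ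
      = a₁ * ∫ x, f₁ x ∂μ
        + s * (a₂ * ∫ x, f₂ x ∂μ + a₃ * (t - ∫ x, f₃ x ∂μ) + a₄ * ∫ x, f₄ x ∂μ) := by
  have i1 := h₁.const_mul a₁
  have i2 := h₂.const_mul a₂
  have i3 : Integrable (fun x => a₃ * (t - f₃ x)) μ := ((integrable_const t).sub h₃).const_mul a₃
  have i4 := h₄.const_mul a₄
  have i23 : Integrable (fun x => a₂ * f₂ x + a₃ * (t - f₃ x)) μ := i2.add i3
  have i234 : Integrable (fun x => a₂ * f₂ x + a₃ * (t - f₃ x) + a₄ * f₄ x) μ := i23.add i4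
  refine ⟨i1.add (i234.const_mul s), ?_⟩
  rw [integral_add i1 (i234.const_mul s), integral_const_mul, integral_const_mul,
    integral_add i23 i4, integral_add i2 i3, integral_const_mul, integral_const_mul,
    integral_const_mul, integral_sub (integrable_const _) h₃]
  simp

/-- The mean over the design of the conditional risk of the mixed estimator, in whitened
coordinates: `z` are the columns of the whitened design, `e` is the normalized vector of ones, and
`b` is the whitened coefficient vector. -/
noncomputable def whitenedRisk (σ α : ℝ) (e : E) (b : Fin p → ℝ) (z : Fin p → E) : ℝ :=
  α ^ 2 * ∑ k, (wishartDeviation (Module.finrank ℝ E)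
      (fun j => (ℝ ∙ e)ᗮ.orthogonalProjectionOnto (z j)) *ᵥ b) k ^ 2
    + σ ^ 2 * ((1 - α) ^ 2 * (Matrix.gram ℝ z)⁻¹.trace
      + 2 * (1 - α) * α / Module.finrank ℝ E * (p - spanLeverage e z)
      + α ^ 2 / (Module.finrank ℝ E : ℝ) ^ 2
        * ∑ j, ‖(ℝ ∙ e)ᗮ.orthogonalProjectionOnto (z j)‖ ^ 2)

lemma integral_whitenedRisk (σ α : ℝ) (hp : p + 2 ≤ Module.finrank ℝ E) {e : E} (he : ‖e‖ = 1)
    (b : Fin p → ℝ) :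
    Integrable (whitenedRisk σ α e b) (Measure.pi fun _ : Fin p => stdGaussian E) ∧
    ∫ z, whitenedRisk σ α e b z ∂(Measure.pi fun _ : Fin p => stdGaussian E)
      = α ^ 2 * (deviationFactor (Module.finrank ℝ E - 1) p (Module.finrank ℝ E)
          * ∑ j, b j ^ 2)
        + σ ^ 2 * ((1 - α) ^ 2 * (p / ((Module.finrank ℝ E : ℝ) - p - 1))
          + 2 * (1 - α) * α / Module.finrank ℝ E * (p - p / Module.finrank ℝ E)
          + α ^ 2 / (Module.finrank ℝ E : ℝ) ^ 2 * (p * ((Module.finrank ℝ E : ℝ) - 1))) := by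
  have hK : Module.finrank ℝ (ℝ ∙ e)ᗮ = Module.finrank ℝ E - 1 := by
    have h1 := Submodule.finrank_add_finrank_orthogonal (ℝ ∙ e)
    rw [finrank_span_singleton (by rintro rfl; simp at he)] at h1
    omega
  have hKr : (Module.finrank ℝ (ℝ ∙ e)ᗮ : ℝ) = (Module.finrank ℝ E : ℝ) - 1 := by
    rw [hK, Nat.cast_sub (by omega)]
    simp
  obtain ⟨hT, hT'⟩ := integral_trace_inv_gram (E := E) hp
  obtain ⟨hq, hq'⟩ := integral_spanLeverage hp he
  obtain ⟨hD, hD'⟩ := integral_orthogonalProjection (integrable_wishartDeviation_mulVec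
    (F := (ℝ ∙ e)ᗮ) (Module.finrank ℝ E) b)
  obtain ⟨hS, hS'⟩ := integral_orthogonalProjection (integrable_sum_norm_sq
    (F := (ℝ ∙ e)ᗮ) (p := p))
  rw [integral_wishartDeviation_mulVec, hK] at hD'
  rw [integral_sum_norm_sq, hKr] at hS'
  rw [← hT', ← hq', ← hD', ← hS']
  exact integral_affine_comb hD hT hq hS _ _ _ _ _ _

end

/-! ### Matrix form of the estimation error -/

section

variable {n p : ℕ}

/-- The centering matrix `I - 11ᵀ / n`. -/
noncomputable def centering (n : ℕ) : Matrix (Fin n) (Fin n) ℝ :=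
  1 - (n : ℝ)⁻¹ • Matrix.vecMulVec (fun _ => 1) (fun _ => 1)

lemma centering_transpose : (centering n)ᵀ = centering n := by
  ext i j
  simp [centering, Matrix.vecMulVec_apply, Matrix.one_apply, eq_comm]

lemma centering_mul_self (hn : n ≠ 0) : centering n * centering n = centering n := by
  have hn' : (n : ℝ) ≠ 0 := by exact_mod_cast hn
  have h : (Matrix.vecMulVec (fun _ => 1) (fun _ => 1) : Matrix (Fin n) (Fin n) ℝ)
      * Matrix.vecMulVec (fun _ => 1) (fun _ => 1)
      = (n : ℝ) • Matrix.vecMulVec (fun _ => 1) (fun _ => 1) := by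
    ext i j
    simp [Matrix.mul_apply, Matrix.vecMulVec_apply]
  rw [centering, sub_mul, mul_sub, mul_sub, Matrix.smul_mul, Matrix.mul_smul, Matrix.smul_mul,
    Matrix.mul_smul, h]
  simp [smul_smul, hn']

/-- The columns of a matrix, as vectors of a Euclidean space. -/
noncomputable def columns (Z : Matrix (Fin n) (Fin p) ℝ) : Fin p → EuclideanSpace ℝ (Fin n) :=
  fun j => WithLp.toLp 2 fun i => Z i j

/-- The unit vector with equal coordinates. -/
noncomputable def onesDirection (n : ℕ) : EuclideanSpace ℝ (Fin n) :=
  WithLp.toLp 2 fun _ => (√n)⁻¹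

lemma norm_onesDirection (hn : n ≠ 0) : ‖onesDirection n‖ = 1 := by
  have hn' : (n : ℝ) ≠ 0 := by exact_mod_cast hn
  have h : ‖onesDirection n‖ ^ 2 = 1 := by
    rw [EuclideanSpace.real_norm_sq_eq]
    simp [onesDirection, hn']
  exact (pow_eq_one_iff_of_nonneg (norm_nonneg _) two_ne_zero).1 h

lemma gram_columns (Z : Matrix (Fin n) (Fin p) ℝ) : Matrix.gram ℝ (columns Z) = Zᵀ * Z := by
  ext j k
  simp [Matrix.gram_apply, columns, Matrix.mul_apply, PiLp.inner_apply, mul_comm]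

lemma inner_columns_onesDirection (Z : Matrix (Fin n) (Fin p) ℝ) (j : Fin p) :
    inner ℝ (columns Z j) (onesDirection n) = (√n)⁻¹ * ∑ i, Z i j := by
  simp [columns, onesDirection, PiLp.inner_apply, Finset.mul_sum]

lemma transpose_mul_centering_mul_apply (Z : Matrix (Fin n) (Fin p) ℝ) (j k : Fin p) :
    (Zᵀ * centering n * Z) j k
      = (Zᵀ * Z) j k - inner ℝ (columns Z j) (onesDirection n)
        * inner ℝ (columns Z k) (onesDirection n) := by
  have h : (Zᵀ * Matrix.vecMulVec (fun _ : Fin n => (1 : ℝ)) (fun _ : Fin n => (1 : ℝ)) * Z) j k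
      = (∑ i, Z i j) * ∑ i, Z i k := by
    rw [Matrix.mul_vecMulVec, Matrix.vecMulVec_mul, Matrix.vecMulVec_apply]
    simp [Matrix.mulVec, Matrix.vecMul, dotProduct]
  rw [centering, Matrix.mul_sub, Matrix.sub_mul, Matrix.mul_one, Matrix.mul_smul,
    Matrix.smul_mul, Matrix.sub_apply,
    Matrix.smul_apply, h, inner_columns_onesDirection, inner_columns_onesDirection, smul_eq_mul]
  have : (n : ℝ)⁻¹ = (√n)⁻¹ * (√n)⁻¹ := by rw [← mul_inv, Real.mul_self_sqrt n.cast_nonneg]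
  rw [this]
  ring

lemma gram_orthogonalProjection_columns (hn : n ≠ 0) (Z : Matrix (Fin n) (Fin p) ℝ) :
    Matrix.gram ℝ (fun j => (ℝ ∙ onesDirection n)ᗮ.orthogonalProjectionOnto (columns Z j))
      = Zᵀ * centering n * Z := by
  ext j k
  rw [transpose_mul_centering_mul_apply, ← gram_columns, Matrix.gram_apply, Matrix.gram_apply,
    Submodule.coe_inner, ← Submodule.starProjection_apply, ← Submodule.starProjection_apply,
    Submodule.inner_starProjection_left_eq_right,
    Submodule.starProjection_eq_self_iff.2 (Submodule.starProjection_apply_mem _ _),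
    Submodule.starProjection_orthogonal_val, inner_sub_right,
    Submodule.starProjection_unit_singleton ℝ (norm_onesDirection hn), inner_smul_right,
    real_inner_comm (columns Z k) (onesDirection n)]
  ring

/-- The matrix that maps the noise to the whitened estimation error of the mixed estimator, for the
whitened design `Z`. -/
noncomputable def noiseMatrix (α : ℝ) (Z : Matrix (Fin n) (Fin p) ℝ) :
    Matrix (Fin p) (Fin n) ℝ :=
  (1 - α) • ((Zᵀ * Z)⁻¹ * Zᵀ) + (α / n) • (Zᵀ * centering n)

lemma sum_noiseMatrix_sq (α : ℝ) (hn : n ≠ 0) {Z : Matrix (Fin n) (Fin p) ℝ}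
    (hZ : IsUnit (Zᵀ * Z).det) :
    ∑ k, ∑ i, noiseMatrix α Z k i ^ 2
      = (1 - α) ^ 2 * (Zᵀ * Z)⁻¹.trace
        + 2 * (1 - α) * α / n * ((Zᵀ * Z)⁻¹ * (Zᵀ * centering n * Z)).trace
        + α ^ 2 / (n : ℝ) ^ 2 * (Zᵀ * centering n * Z).trace := by
  have h1 : ∑ k, ∑ i, noiseMatrix α Z k i ^ 2
      = (noiseMatrix α Z * (noiseMatrix α Z)ᵀ).trace := by
    simp [Matrix.trace, Matrix.mul_apply, sq]
  have hsym : ((Zᵀ * Z)⁻¹)ᵀ = (Zᵀ * Z)⁻¹ := by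
    rw [Matrix.transpose_nonsing_inv, Matrix.transpose_mul, Matrix.transpose_transpose]
  have h2 : (noiseMatrix α Z)ᵀ = (1 - α) • (Z * (Zᵀ * Z)⁻¹) + (α / n) • (centering n * Z) := by
    simp only [noiseMatrix, Matrix.transpose_add, Matrix.transpose_smul, Matrix.transpose_mul,
      hsym, Matrix.transpose_transpose, centering_transpose]
  have e1 : (Zᵀ * Z)⁻¹ * Zᵀ * (Z * (Zᵀ * Z)⁻¹) = (Zᵀ * Z)⁻¹ := by
    rw [Matrix.mul_assoc, ← Matrix.mul_assoc Zᵀ Z, Matrix.mul_nonsing_inv _ hZ, mul_one]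
  have e2 : (Zᵀ * Z)⁻¹ * Zᵀ * (centering n * Z) = (Zᵀ * Z)⁻¹ * (Zᵀ * centering n * Z) := by
    simp only [Matrix.mul_assoc]
  have e3 : (Zᵀ * centering n * (Z * (Zᵀ * Z)⁻¹)).trace
      = ((Zᵀ * Z)⁻¹ * (Zᵀ * centering n * Z)).trace := by
    rw [← Matrix.mul_assoc, Matrix.trace_mul_comm]
  have e4 : Zᵀ * centering n * (centering n * Z) = Zᵀ * centering n * Z := by
    rw [← Matrix.mul_assoc, Matrix.mul_assoc Zᵀ, centering_mul_self hn]
  rw [h1, h2, noiseMatrix]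
  simp only [Matrix.add_mul, Matrix.mul_add, Matrix.smul_mul, Matrix.mul_smul, Matrix.trace_add,
    Matrix.trace_smul, e1, e2, e3, e4, smul_eq_mul]
  ring

/-- The trace of the product of the centering matrix with the projection to the column space. -/
lemma trace_inv_mul_centered {Z : Matrix (Fin n) (Fin p) ℝ} (hZ : IsUnit (Zᵀ * Z).det) :
    ((Zᵀ * Z)⁻¹ * (Zᵀ * centering n * Z)).trace
      = p - spanLeverage (onesDirection n) (columns Z) := by
  have hs : ∀ j k, (Zᵀ * Z) j k = (Zᵀ * Z) k j := fun j k => by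
    simp [Matrix.mul_apply, mul_comm]
  have h : ((Zᵀ * Z)⁻¹ * (Zᵀ * Z)).trace = p := by
    rw [Matrix.nonsing_inv_mul _ hZ]
    simp
  rw [spanLeverage_eq_sum, gram_columns, ← h, Matrix.trace, Matrix.trace,
    ← Finset.sum_sub_distrib]
  refine Finset.sum_congr rfl fun j _ => ?_
  rw [Matrix.diag_apply, Matrix.diag_apply, Matrix.mul_apply, Matrix.mul_apply,
    ← Finset.sum_sub_distrib]
  refine Finset.sum_congr rfl fun k _ => ?_
  rw [transpose_mul_centering_mul_apply]
  ring

/-- The conditional risk given the design is a squared bias plus a variance. -/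
lemma whitenedRisk_columns (σ α : ℝ) (hn : n ≠ 0) {Z : Matrix (Fin n) (Fin p) ℝ}
    (hZ : IsUnit (Zᵀ * Z).det) (b : Fin p → ℝ) :
    whitenedRisk σ α (onesDirection n) b (columns Z)
      = ∑ k, (α * (((n : ℝ)⁻¹ • (Zᵀ * centering n * Z) - 1) *ᵥ b) k) ^ 2
        + σ ^ 2 * ∑ k, ∑ i, noiseMatrix α Z k i ^ 2 := by
  have hS : ∑ j, ‖(ℝ ∙ onesDirection n)ᗮ.orthogonalProjectionOnto (columns Z j)‖ ^ 2
      = (Zᵀ * centering n * Z).trace := by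
    rw [← gram_orthogonalProjection_columns hn, Matrix.trace]
    exact Finset.sum_congr rfl fun j _ => (real_inner_self_eq_norm_sq _).symm
  rw [whitenedRisk, hS, sum_noiseMatrix_sq α hn hZ, trace_inv_mul_centered hZ, gram_columns,
    wishartDeviation, gram_orthogonalProjection_columns hn, finrank_euclideanSpace_fin]
  simp only [mul_pow, Finset.mul_sum]

lemma semiSupervised_rhs (hn : n ≠ 0) (xs : Fin n → EuclideanSpace ℝ (Fin p)) (y : Fin n → ℝ) :
    (designMatrix xs)ᵀ *ᵥ y - ((n : ℝ) * responseMean y) • covariateMean xs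
      = ((designMatrix xs)ᵀ * centering n) *ᵥ y := by
  have hn' : (n : ℝ) ≠ 0 := by exact_mod_cast hn
  rw [centering, Matrix.mul_sub, Matrix.mul_one, Matrix.sub_mulVec, Matrix.mul_smul,
    Matrix.smul_mulVec]
  congr 1
  ext j
  rw [Matrix.mul_vecMulVec]
  simp only [Pi.smul_apply, covariateMean, responseMean, smul_eq_mul, Matrix.mulVec, dotProduct,
    Matrix.vecMulVec_apply, designMatrix, Matrix.transpose_apply, Matrix.of_apply, mul_one,
    ← Finset.mul_sum]
  field_simp

/-- In whitened coordinates the estimation error of the mixed estimator is the sum of a multiple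
of the deviation of the centered Gram matrix from its mean, applied to the coefficients, and a
linear function of the noise. -/
lemma mulVec_mixedEstimator_sub {Px : Measure (EuclideanSpace ℝ (Fin p))} (α : ℝ) (hn : n ≠ 0)
    {S R : Matrix (Fin p) (Fin p) ℝ} (hH : expectedGram n Px = (n : ℝ) • S) (hRR : R * R = S)
    (hRT : Rᵀ = R) (hR : IsUnit R.det) (xs : Fin n → EuclideanSpace ℝ (Fin p))
    {Z : Matrix (Fin n) (Fin p) ℝ} (hX : designMatrix xs = Z * R)
    (hZ : IsUnit (Zᵀ * Z).det) (y : Fin n → ℝ) (β : Fin p → ℝ) :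
    R *ᵥ (mixedEstimator Px α xs y - β)
      = α • (((n : ℝ)⁻¹ • (Zᵀ * centering n * Z) - 1) *ᵥ (R *ᵥ β))
        + noiseMatrix α Z *ᵥ (y - designMatrix xs *ᵥ β) := by
  have hn' : (n : ℝ) ≠ 0 := by exact_mod_cast hn
  have hXT : (designMatrix xs)ᵀ = R * Zᵀ := by rw [hX, Matrix.transpose_mul, hRT]
  have hOLS : R * (((designMatrix xs)ᵀ * designMatrix xs)⁻¹ * (designMatrix xs)ᵀ)
      = (Zᵀ * Z)⁻¹ * Zᵀ := by
    have e : (designMatrix xs)ᵀ * designMatrix xs = R * (Zᵀ * Z) * R := by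
      rw [hXT, hX]; simp only [Matrix.mul_assoc]
    rw [e, Matrix.mul_inv_rev, Matrix.mul_inv_rev, hXT]
    calc R * (R⁻¹ * ((Zᵀ * Z)⁻¹ * R⁻¹) * (R * Zᵀ))
        = (R * R⁻¹) * (Zᵀ * Z)⁻¹ * (R⁻¹ * R) * Zᵀ := by simp only [Matrix.mul_assoc]
      _ = (Zᵀ * Z)⁻¹ * Zᵀ := by
        rw [Matrix.mul_nonsing_inv _ hR, Matrix.nonsing_inv_mul _ hR, one_mul, mul_one]
  have hSSL : R * ((expectedGram n Px)⁻¹ * ((designMatrix xs)ᵀ * centering n))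
      = (n : ℝ)⁻¹ • (Zᵀ * centering n) := by
    have e : (expectedGram n Px)⁻¹ = (n : ℝ)⁻¹ • (R⁻¹ * R⁻¹) := by
      rw [hH, ← hRR]
      refine Matrix.inv_eq_right_inv ?_
      rw [Matrix.smul_mul, Matrix.mul_smul, smul_smul, mul_inv_cancel₀ hn', one_smul]
      calc R * R * (R⁻¹ * R⁻¹) = R * (R * R⁻¹) * R⁻¹ := by simp only [Matrix.mul_assoc]
        _ = 1 := by rw [Matrix.mul_nonsing_inv _ hR, mul_one, Matrix.mul_nonsing_inv _ hR]
    rw [e, hXT, Matrix.smul_mul, Matrix.mul_smul]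
    congr 1
    calc R * (R⁻¹ * R⁻¹ * (R * Zᵀ * centering n))
        = (R * R⁻¹) * (R⁻¹ * R) * Zᵀ * centering n := by simp only [Matrix.mul_assoc]
      _ = Zᵀ * centering n := by
        rw [Matrix.mul_nonsing_inv _ hR, Matrix.nonsing_inv_mul _ hR, one_mul, Matrix.one_mul]
  have hest : R *ᵥ mixedEstimator Px α xs y = noiseMatrix α Z *ᵥ y := by
    rw [mixedEstimator, supervisedEstimator, semiSupervisedEstimator, semiSupervised_rhs hn,
      Matrix.mulVec_add, Matrix.mulVec_smul, Matrix.mulVec_smul, Matrix.mulVec_mulVec,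
      Matrix.mulVec_mulVec, Matrix.mulVec_mulVec, Matrix.mulVec_mulVec, Matrix.mul_assoc R,
      Matrix.mul_assoc R, hOLS, hSSL, noiseMatrix,
      Matrix.add_mulVec, Matrix.smul_mulVec, Matrix.smul_mulVec, Matrix.smul_mulVec, smul_smul,
      div_eq_mul_inv]
  have hNZ : noiseMatrix α Z * Z
      = 1 + α • ((n : ℝ)⁻¹ • (Zᵀ * centering n * Z) - 1) := by
    rw [noiseMatrix, Matrix.add_mul, Matrix.smul_mul, Matrix.smul_mul, Matrix.mul_assoc,
      Matrix.nonsing_inv_mul _ hZ, smul_sub, smul_smul, ← div_eq_mul_inv, sub_smul, one_smul]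
    abel
  have hb : noiseMatrix α Z *ᵥ (designMatrix xs *ᵥ β)
      = R *ᵥ β + α • (((n : ℝ)⁻¹ • (Zᵀ * centering n * Z) - 1) *ᵥ (R *ᵥ β)) := by
    rw [hX, ← Matrix.mulVec_mulVec, Matrix.mulVec_mulVec, hNZ, Matrix.add_mulVec,
      Matrix.one_mulVec, Matrix.smul_mulVec]
  rw [Matrix.mulVec_sub, hest, Matrix.mulVec_sub, hb]
  abel

end

/-! ### Gaussian designs, responses and covariates -/

section

open scoped MatrixOrder

variable {n p : ℕ}

lemma measurePreserving_pi_swap {X : Type*} [MeasurableSpace X] (μ : Measure X)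
    [IsProbabilityMeasure μ] :
    MeasurePreserving (fun (x : Fin n → Fin p → X) j i => x i j)
      (Measure.pi fun _ => Measure.pi fun _ => μ) (Measure.pi fun _ => Measure.pi fun _ => μ) := by
  have hc : ∀ a b : ℕ, (Measure.pi fun _ : Fin a × Fin b => μ).map (MeasurableEquiv.curry _ _ X)
      = Measure.pi fun _ => Measure.pi fun _ => μ := fun a b => by
    have := Measure.infinitePi_map_curry (fun (_ : Fin a) (_ : Fin b) => μ)
    simpa only [Measure.infinitePi_eq_pi] using this
  have hs := measurePreserving_piCongrLeft (fun _ : Fin p × Fin n => μ)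
    (Equiv.prodComm (Fin n) (Fin p))
  refine ⟨by fun_prop, ?_⟩
  rw [← hc n p, Measure.map_map (by fun_prop) (by fun_prop), ← hc p n, ← hs.map_eq,
    Measure.map_map (by fun_prop) (by fun_prop)]
  congr 1

lemma measurePreserving_toLp_pi (n p : ℕ) :
    MeasurePreserving (fun (x : Fin n → Fin p → ℝ) i => WithLp.toLp 2 (x i))
      (Measure.pi fun _ => Measure.pi fun _ => gaussianReal 0 1)
      (Measure.pi fun _ => stdGaussian (EuclideanSpace ℝ (Fin p))) :=
  measurePreserving_pi _ _ fun _ => ⟨by fun_prop, map_pi_eq_stdGaussian⟩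

/-- The columns of a matrix with standard Gaussian rows are standard Gaussian. -/
lemma measurePreserving_columns_stdGaussian :
    MeasurePreserving (fun xs : Fin n → EuclideanSpace ℝ (Fin p) => columns (designMatrix xs))
      (Measure.pi fun _ => stdGaussian (EuclideanSpace ℝ (Fin p)))
      (Measure.pi fun _ => stdGaussian (EuclideanSpace ℝ (Fin n))) := by
  have hm : Measurable
      (fun xs : Fin n → EuclideanSpace ℝ (Fin p) => columns (designMatrix xs)) := by
    unfold columns designMatrix
    simp only [Matrix.of_apply]
    fun_prop
  refine ⟨hm, ?_⟩
  rw [← (measurePreserving_toLp_pi n p).map_eq,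
    Measure.map_map hm (measurePreserving_toLp_pi n p).measurable,
    ← ((measurePreserving_toLp_pi p n).comp (measurePreserving_pi_swap (gaussianReal 0 1))).map_eq]
  rfl

lemma transpose_sqrt (S : Matrix (Fin p) (Fin p) ℝ) : (CFC.sqrt S)ᵀ = CFC.sqrt S := by
  have := (CFC.sqrt_nonneg S).isSelfAdjoint.star_eq
  rwa [Matrix.star_eq_conjTranspose, Matrix.conjTranspose_eq_transpose_of_trivial] at this

lemma isUnit_det_sqrt {S : Matrix (Fin p) (Fin p) ℝ} (hS : S.PosDef) :
    IsUnit (CFC.sqrt S).det := by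
  have h : CFC.sqrt S * CFC.sqrt S = S := CFC.sqrt_mul_sqrt_self _ hS.posSemidef.nonneg
  refine isUnit_iff_ne_zero.2 fun h0 => hS.det_pos.ne' ?_
  rw [← h, Matrix.det_mul, h0, zero_mul]

lemma measurePreserving_whiten {S : Matrix (Fin p) (Fin p) ℝ} (hS : S.PosDef) :
    MeasurePreserving
      (fun x : EuclideanSpace ℝ (Fin p) => WithLp.toLp 2 (x.ofLp ᵥ* (CFC.sqrt S)⁻¹))
      (multivariateGaussian 0 S) (stdGaussian _) := by
  have hm : Measurable
      (fun x : EuclideanSpace ℝ (Fin p) => WithLp.toLp 2 (x.ofLp ᵥ* (CFC.sqrt S)⁻¹)) := by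
    unfold Matrix.vecMul dotProduct
    fun_prop
  refine ⟨hm, ?_⟩
  rw [multivariateGaussian, Measure.map_map hm (by fun_prop)]
  convert Measure.map_id using 2
  ext x j
  have : (CFC.sqrt S *ᵥ x.ofLp) ᵥ* (CFC.sqrt S)⁻¹ = x.ofLp := by
    rw [← transpose_sqrt S, Matrix.mulVec_transpose, Matrix.vecMul_vecMul, transpose_sqrt,
      Matrix.mul_nonsing_inv _ (isUnit_det_sqrt hS), Matrix.vecMul_one]
  simp [this]

/-- The columns of a Gaussian design matrix whose rows have been whitened are independent standard
Gaussian vectors. -/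
lemma measurePreserving_columns_whiten {S : Matrix (Fin p) (Fin p) ℝ} (hS : S.PosDef) :
    MeasurePreserving (fun xs : Fin n → EuclideanSpace ℝ (Fin p) =>
        columns (designMatrix xs * (CFC.sqrt S)⁻¹))
      (Measure.pi fun _ => multivariateGaussian 0 S)
      (Measure.pi fun _ => stdGaussian (EuclideanSpace ℝ (Fin n))) :=
  measurePreserving_columns_stdGaussian.comp
    (measurePreserving_pi _ _ fun _ => measurePreserving_whiten hS)

lemma expectedGram_multivariateGaussian {S : Matrix (Fin p) (Fin p) ℝ} (hS : S.PosDef) :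
    expectedGram n (multivariateGaussian 0 S) = (n : ℝ) • S := by
  have hL : ∀ j, MemLp (fun x : EuclideanSpace ℝ (Fin p) => x j) 2
      (multivariateGaussian 0 S) := fun j =>
    IsGaussian.memLp_dual (multivariateGaussian 0 S) (EuclideanSpace.proj j) 2 (by simp)
  have h0 : ∀ j, ∫ x : EuclideanSpace ℝ (Fin p), x j ∂(multivariateGaussian 0 S) = 0 := fun j => by
    have := IsGaussian.integral_dual (μ := multivariateGaussian 0 S)
      (EuclideanSpace.proj j : EuclideanSpace ℝ (Fin p) →L[ℝ] ℝ)
    rw [integral_id_multivariateGaussian] at this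
    simpa using this
  have h1 : ∀ j k, ∫ x : EuclideanSpace ℝ (Fin p), x j * x k ∂(multivariateGaussian 0 S)
      = S j k := fun j k => by
    have := covariance_eval_multivariateGaussian (μ := 0) hS.posSemidef j k
    rw [covariance_eq_sub (hL j) (hL k), h0, zero_mul, sub_zero] at this
    exact this
  ext j k
  have hi : ∀ i : Fin n, Integrable (fun xs : Fin n → EuclideanSpace ℝ (Fin p) =>
      xs i j * xs i k) (Measure.pi fun _ => multivariateGaussian 0 S) := fun i =>
    (measurePreserving_eval (fun _ : Fin n => multivariateGaussian 0 S)
      i).integrable_comp_of_integrable ((hL j).integrable_mul (hL k))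
  have h2 : ∀ i : Fin n, ∫ xs : Fin n → EuclideanSpace ℝ (Fin p), xs i j * xs i k
      ∂(Measure.pi fun _ => multivariateGaussian 0 S) = S j k := fun i => by
    have hmp := measurePreserving_eval (fun _ : Fin n => multivariateGaussian 0 S) i
    have h3 := integral_map (μ := Measure.pi fun _ : Fin n => multivariateGaussian 0 S)
      (f := fun x : EuclideanSpace ℝ (Fin p) => x j * x k) hmp.measurable.aemeasurable
      (Measurable.aestronglyMeasurable (by fun_prop))
    rw [hmp.map_eq, h1] at h3
    exact h3.symm
  simp only [expectedGram, Matrix.of_apply, Matrix.mul_apply, Matrix.transpose_apply, designMatrix]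
  rw [integral_finsetSum _ fun i _ => hi i]
  simp [h2]

lemma lintegral_dotProduct_sq_multivariateGaussian (S : Matrix (Fin p) (Fin p) ℝ)
    (v : Fin p → ℝ) :
    ∫⁻ x : EuclideanSpace ℝ (Fin p), ENNReal.ofReal ((x.ofLp ⬝ᵥ v) ^ 2)
        ∂(multivariateGaussian 0 S)
      = ENNReal.ofReal (∑ k, (CFC.sqrt S *ᵥ v) k ^ 2) := by
  have hmeas : Measurable fun x : EuclideanSpace ℝ (Fin p) =>
      ENNReal.ofReal ((x.ofLp ⬝ᵥ v) ^ 2) := by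
    unfold dotProduct
    fun_prop
  rw [multivariateGaussian, lintegral_map hmeas (by fun_prop)]
  have h1 : ∀ x : EuclideanSpace ℝ (Fin p),
      (0 + Matrix.toEuclideanCLM (𝕜 := ℝ) (CFC.sqrt S) x).ofLp ⬝ᵥ v
        = inner ℝ x (WithLp.toLp 2 (CFC.sqrt S *ᵥ v)) := fun x => by
    have h2 : (CFC.sqrt S *ᵥ x.ofLp) ⬝ᵥ v = (CFC.sqrt S *ᵥ v) ⬝ᵥ x.ofLp := by
      rw [dotProduct_comm, Matrix.dotProduct_mulVec, ← Matrix.mulVec_transpose, transpose_sqrt]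
    simpa [EuclideanSpace.inner_eq_star_dotProduct] using h2
  simp_rw [h1]
  rw [← ofReal_integral_eq_lintegral_ofReal _ (ae_of_all _ fun _ => sq_nonneg _),
    integral_inner_sq_stdGaussian, EuclideanSpace.real_norm_sq_eq]
  refine MemLp.integrable_sq ?_
  simpa [real_inner_comm] using IsGaussian.memLp_dual (stdGaussian (EuclideanSpace ℝ (Fin p)))
    (innerSL ℝ (WithLp.toLp 2 (CFC.sqrt S *ᵥ v))) 2 (by simp)

lemma integral_sq_affine_pi {σ : ℝ} {μ : Fin n → Measure ℝ} [∀ i, IsProbabilityMeasure (μ i)]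
    (hL : ∀ i, MemLp id 2 (μ i)) {m : Fin n → ℝ} (hm : ∀ i, ∫ y, y ∂(μ i) = m i)
    (hv : ∀ i, Var[id; μ i] = σ ^ 2) (a : ℝ) (w : Fin n → ℝ) :
    Integrable (fun y : Fin n → ℝ => (a + w ⬝ᵥ (y - m)) ^ 2) (Measure.pi μ) ∧
    ∫ y : Fin n → ℝ, (a + w ⬝ᵥ (y - m)) ^ 2 ∂(Measure.pi μ) = a ^ 2 + σ ^ 2 * ∑ i, w i ^ 2 := by
  set f : Fin n → ℝ → ℝ := fun i t => w i * (t - m i) with hf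
  have hfL : ∀ i, MemLp (f i) 2 (μ i) := fun i => ((hL i).sub (memLp_const (m i))).const_mul (w i)
  have hfv : ∀ i, Var[f i; μ i] = w i ^ 2 * σ ^ 2 := fun i => by
    rw [hf]
    simp only [sub_eq_add_neg]
    have h1 : Var[fun t => t + -m i; μ i] = Var[id; μ i] :=
      variance_add_const aestronglyMeasurable_id _
    rw [variance_const_mul, h1, hv i]
  have hfm : ∀ i, ∫ t, f i t ∂(μ i) = 0 := fun i => by
    rw [hf]
    simp only
    have hi : Integrable (fun y => y) (μ i) := (hL i).integrable one_le_two
    rw [integral_const_mul, integral_sub hi (integrable_const _), hm i]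
    simp
  have hfL' : ∀ i, MemLp (fun y : Fin n → ℝ => f i (y i)) 2 (Measure.pi μ) := fun i =>
    (hfL i).comp_measurePreserving (measurePreserving_eval μ i)
  have hfm' : ∀ i, ∫ y : Fin n → ℝ, f i (y i) ∂(Measure.pi μ) = 0 := fun i => by
    rw [← hfm i]
    exact integral_comp_eval (hfL i).aestronglyMeasurable
  have e : ∀ y : Fin n → ℝ, a + w ⬝ᵥ (y - m) = a + (∑ i, fun y : Fin n → ℝ => f i (y i)) y :=
    fun y => by simp [dotProduct, hf]
  have hsL : MemLp (∑ i, fun y : Fin n → ℝ => f i (y i)) 2 (Measure.pi μ) :=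
    memLp_finsetSum' _ fun i _ => hfL' i
  have hL2 : MemLp (fun y : Fin n → ℝ => a + w ⬝ᵥ (y - m)) 2 (Measure.pi μ) := by
    simp_rw [e]
    exact (memLp_const a).add hsL
  refine ⟨hL2.integrable_sq, ?_⟩
  have hV := variance_eq_sub hL2
  have hmean : ∫ y : Fin n → ℝ, (a + w ⬝ᵥ (y - m)) ∂(Measure.pi μ) = a := by
    simp_rw [e]
    rw [integral_add (integrable_const _) (hsL.integrable one_le_two)]
    simp only [Finset.sum_apply]
    rw [integral_finsetSum _ fun i _ => (hfL' i).integrable one_le_two]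
    simp [hfm']
  have hvar : Var[fun y : Fin n → ℝ => a + w ⬝ᵥ (y - m); Measure.pi μ] = σ ^ 2 * ∑ i, w i ^ 2 := by
    simp_rw [e]
    rw [variance_const_add hsL.aestronglyMeasurable, variance_sum_pi hfL, Finset.mul_sum]
    exact Finset.sum_congr rfl fun i _ => by rw [hfv i, mul_comm]
  rw [hmean, hvar] at hV
  simp only [Pi.pow_apply] at hV
  linarith

/-- The bias-variance decomposition of an affine function of independent responses with means `m`
and common variance `σ²`. -/
lemma lintegral_sum_sq_affine_pi {σ : ℝ} {μ : Fin n → Measure ℝ}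
    [∀ i, IsProbabilityMeasure (μ i)] (hL : ∀ i, MemLp id 2 (μ i)) {m : Fin n → ℝ}
    (hm : ∀ i, ∫ y, y ∂(μ i) = m i) (hv : ∀ i, Var[id; μ i] = σ ^ 2) (a : Fin p → ℝ)
    (M : Matrix (Fin p) (Fin n) ℝ) :
    ∫⁻ y : Fin n → ℝ, ENNReal.ofReal (∑ k, (a + M *ᵥ (y - m)) k ^ 2) ∂(Measure.pi μ)
      = ENNReal.ofReal (∑ k, a k ^ 2 + σ ^ 2 * ∑ k, ∑ i, M k i ^ 2) := by
  have h := fun k => integral_sq_affine_pi hL hm hv (a k) (M k)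
  have e : ∀ y : Fin n → ℝ, ∑ k, (a + M *ᵥ (y - m)) k ^ 2
      = ∑ k, (a k + M k ⬝ᵥ (y - m)) ^ 2 := fun y => rfl
  simp_rw [e]
  rw [← ofReal_integral_eq_lintegral_ofReal (integrable_finsetSum _ fun k _ => (h k).1)
    (ae_of_all _ fun _ => Finset.sum_nonneg fun _ _ => sq_nonneg _),
    integral_finsetSum _ fun k _ => (h k).1]
  simp only [(h _).2, Finset.sum_add_distrib, Finset.mul_sum]

end

/-! ### The reducible error of the mixed estimator -/

section

open scoped MatrixOrder

variable {n p : ℕ}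

/-- The conditional risk of the mixed estimator given the coefficients and the design. -/
lemma lintegral_mixedEstimator_of_design {σ : ℝ} (α : ℝ) (hn : n ≠ 0)
    {S : Matrix (Fin p) (Fin p) ℝ} (hS : S.PosDef)
    (κ : Kernel (EuclideanSpace ℝ (Fin p) × EuclideanSpace ℝ (Fin p)) ℝ) [IsMarkovKernel κ]
    {β : EuclideanSpace ℝ (Fin p)} {xs : Fin n → EuclideanSpace ℝ (Fin p)}
    (hL : ∀ i, MemLp id 2 (κ (β, xs i))) (hm : ∀ i, ∫ y, y ∂(κ (β, xs i)) = (xs i).ofLp ⬝ᵥ β.ofLp)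
    (hv : ∀ i, Var[id; κ (β, xs i)] = σ ^ 2)
    (hZ : LinearIndependent ℝ (columns (designMatrix xs * (CFC.sqrt S)⁻¹))) :
    ∫⁻ y : Fin n → ℝ, ∫⁻ x₀, ENNReal.ofReal
        ((x₀.ofLp ⬝ᵥ mixedEstimator (multivariateGaussian 0 S) α xs y
          - x₀.ofLp ⬝ᵥ β.ofLp) ^ 2)
        ∂(multivariateGaussian 0 S) ∂(Measure.pi fun i => κ (β, xs i))
      = ENNReal.ofReal (whitenedRisk σ α (onesDirection n) (CFC.sqrt S *ᵥ β.ofLp)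
          (columns (designMatrix xs * (CFC.sqrt S)⁻¹))) := by
  set Z := designMatrix xs * (CFC.sqrt S)⁻¹ with hZdef
  have hR := isUnit_det_sqrt hS
  have hX : designMatrix xs = Z * CFC.sqrt S := by
    rw [hZdef, Matrix.mul_assoc, Matrix.nonsing_inv_mul _ hR, Matrix.mul_one]
  have hdet : IsUnit (Zᵀ * Z).det := by
    rw [← gram_columns]
    exact isUnit_iff_ne_zero.2 ((Matrix.det_gram_ne_zero_iff_linearIndependent).2 hZ)
  rw [whitenedRisk_columns σ α hn hdet]
  simp_rw [← dotProduct_sub, lintegral_dotProduct_sq_multivariateGaussian,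
    mulVec_mixedEstimator_sub α hn (expectedGram_multivariateGaussian hS)
      (CFC.sqrt_mul_sqrt_self _ hS.posSemidef.nonneg) (transpose_sqrt S) hR xs hX hdet]
  exact lintegral_sum_sq_affine_pi hL hm hv _ _

/-- The reducible error of the mixed estimator, as a function of the sample size `n`, the dimension
`p`, the noise level `σ`, the signal strength `t = τ² tr Σ` and the mixing ratio `α`. -/
noncomputable def mixedRisk (n p : ℕ) (σ t α : ℝ) : ℝ :=
  α ^ 2 * (deviationFactor (n - 1) p n * t)
    + σ ^ 2 * ((1 - α) ^ 2 * (p / ((n : ℝ) - p - 1))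
      + 2 * (1 - α) * α / n * (p - p / n) + α ^ 2 / (n : ℝ) ^ 2 * (p * ((n : ℝ) - 1)))

/-- The conditional risk of the mixed estimator given the coefficients. -/
lemma lintegral_mixedEstimator_of_coefficient {σ : ℝ} (α : ℝ) (hp : p + 2 ≤ n)
    {S : Matrix (Fin p) (Fin p) ℝ} (hS : S.PosDef)
    (κ : Kernel (EuclideanSpace ℝ (Fin p) × EuclideanSpace ℝ (Fin p)) ℝ) [IsMarkovKernel κ]
    {β : EuclideanSpace ℝ (Fin p)}
    (hL : ∀ᵐ x ∂(multivariateGaussian 0 S), MemLp id 2 (κ (β, x)))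
    (hm : ∀ᵐ x ∂(multivariateGaussian 0 S), ∫ y, y ∂(κ (β, x)) = x.ofLp ⬝ᵥ β.ofLp)
    (hv : ∀ᵐ x ∂(multivariateGaussian 0 S), Var[id; κ (β, x)] = σ ^ 2) :
    0 ≤ mixedRisk n p σ (∑ j, (CFC.sqrt S *ᵥ β.ofLp) j ^ 2) α ∧
    ∫⁻ xs : Fin n → EuclideanSpace ℝ (Fin p), ∫⁻ y : Fin n → ℝ, ∫⁻ x₀, ENNReal.ofReal
        ((x₀.ofLp ⬝ᵥ mixedEstimator (multivariateGaussian 0 S) α xs y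
          - x₀.ofLp ⬝ᵥ β.ofLp) ^ 2)
        ∂(multivariateGaussian 0 S) ∂(Measure.pi fun i => κ (β, xs i))
        ∂(Measure.pi fun _ => multivariateGaussian 0 S)
      = ENNReal.ofReal (mixedRisk n p σ (∑ j, (CFC.sqrt S *ᵥ β.ofLp) j ^ 2) α) := by
  have hn : n ≠ 0 := by omega
  have hfr : Module.finrank ℝ (EuclideanSpace ℝ (Fin n)) = n := finrank_euclideanSpace_fin
  have hmp := measurePreserving_columns_whiten (n := n) hS
  obtain ⟨hint, hval⟩ := integral_whitenedRisk (E := EuclideanSpace ℝ (Fin n)) σ α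
    (by rw [hfr]; exact hp) (norm_onesDirection hn) (CFC.sqrt S *ᵥ β.ofLp)
  rw [hfr] at hval
  have hli : ∀ᵐ xs ∂(Measure.pi fun _ : Fin n => multivariateGaussian 0 S),
      LinearIndependent ℝ (columns (designMatrix xs * (CFC.sqrt S)⁻¹)) :=
    hmp.quasiMeasurePreserving.ae (ae_linearIndependent_stdGaussian (by rw [hfr]; exact hp))
  have hall : ∀ {P : EuclideanSpace ℝ (Fin p) → Prop}, (∀ᵐ x ∂(multivariateGaussian 0 S), P x) →
      ∀ᵐ xs ∂(Measure.pi fun _ : Fin n => multivariateGaussian 0 S), ∀ i, P (xs i) := fun h =>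
    ae_all_iff.2 fun i =>
      (measurePreserving_eval (fun _ : Fin n => multivariateGaussian 0 S)
        i).quasiMeasurePreserving.ae h
  have hnn : ∀ᵐ xs ∂(Measure.pi fun _ : Fin n => multivariateGaussian 0 S),
      0 ≤ whitenedRisk σ α (onesDirection n) (CFC.sqrt S *ᵥ β.ofLp)
          (columns (designMatrix xs * (CFC.sqrt S)⁻¹)) := by
    filter_upwards [hli] with xs hxs
    have hdet := isUnit_iff_ne_zero.2 ((Matrix.det_gram_ne_zero_iff_linearIndependent).2 hxs)
    rw [gram_columns] at hdet
    rw [whitenedRisk_columns σ α hn hdet]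
    positivity
  have hint' : Integrable (fun xs => whitenedRisk σ α (onesDirection n) (CFC.sqrt S *ᵥ β.ofLp)
      (columns (designMatrix xs * (CFC.sqrt S)⁻¹)))
      (Measure.pi fun _ : Fin n => multivariateGaussian 0 S) :=
    hmp.integrable_comp_of_integrable hint
  have hval' : ∫ xs, whitenedRisk σ α (onesDirection n) (CFC.sqrt S *ᵥ β.ofLp)
          (columns (designMatrix xs * (CFC.sqrt S)⁻¹))
        ∂(Measure.pi fun _ : Fin n => multivariateGaussian 0 S)
      = mixedRisk n p σ (∑ j, (CFC.sqrt S *ᵥ β.ofLp) j ^ 2) α := by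
    rw [mixedRisk, ← hval]
    have h1 := integral_map (μ := Measure.pi fun _ : Fin n => multivariateGaussian 0 S)
      (f := whitenedRisk σ α (onesDirection n) (CFC.sqrt S *ᵥ β.ofLp))
      hmp.measurable.aemeasurable (by rw [hmp.map_eq]; exact hint.aestronglyMeasurable)
    rw [hmp.map_eq] at h1
    exact h1.symm
  refine ⟨hval' ▸ integral_nonneg_of_ae hnn, ?_⟩
  rw [← hval', ofReal_integral_eq_lintegral_ofReal hint' hnn]
  refine lintegral_congr_ae ?_
  filter_upwards [hli, hall hL, hall hm, hall hv] with xs h1 h2 h3 h4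
  exact lintegral_mixedEstimator_of_design α hn hS κ h2 h3 h4 h1

lemma integral_mulVec_sqrt_sq {τ : ℝ} {Pβ : Measure (EuclideanSpace ℝ (Fin p))}
    (hPβ : IsIsotropicPrior τ Pβ) {S : Matrix (Fin p) (Fin p) ℝ} (hS : S.PosDef) :
    Integrable (fun β : EuclideanSpace ℝ (Fin p) => ∑ j, (CFC.sqrt S *ᵥ β.ofLp) j ^ 2) Pβ ∧
    ∫ β : EuclideanSpace ℝ (Fin p), ∑ j, (CFC.sqrt S *ᵥ β.ofLp) j ^ 2 ∂Pβ
      = τ ^ 2 * S.trace := by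
  have hRR : CFC.sqrt S * CFC.sqrt S = S := CFC.sqrt_mul_sqrt_self _ hS.posSemidef.nonneg
  have hL : ∀ j, MemLp (fun β : EuclideanSpace ℝ (Fin p) => β j) 2 Pβ := fun j =>
    (EuclideanSpace.proj j : EuclideanSpace ℝ (Fin p) →L[ℝ] ℝ).comp_memLp' hPβ.memLp
  have hint : ∀ i j k, Integrable (fun β : EuclideanSpace ℝ (Fin p) =>
      CFC.sqrt S i j * CFC.sqrt S i k * (β j * β k)) Pβ := fun i j k =>
    ((hL j).integrable_mul (hL k)).const_mul _
  simp_rw [mulVec_sq_sum_eq]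
  refine ⟨integrable_finsetSum _ fun i _ => integrable_finsetSum _ fun j _ =>
    integrable_finsetSum _ fun k _ => hint i j k, ?_⟩
  rw [integral_finsetSum _ fun i _ => integrable_finsetSum _ fun j _ =>
    integrable_finsetSum _ fun k _ => hint i j k]
  have h1 : ∀ i, ∫ β : EuclideanSpace ℝ (Fin p), ∑ j, ∑ k,
      CFC.sqrt S i j * CFC.sqrt S i k * (β.ofLp j * β.ofLp k) ∂Pβ = τ ^ 2 * S i i := fun i => by
    rw [integral_finsetSum _ fun j _ => integrable_finsetSum _ fun k _ => hint i j k]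
    have h2 : ∀ j, ∫ β : EuclideanSpace ℝ (Fin p), ∑ k,
        CFC.sqrt S i j * CFC.sqrt S i k * (β.ofLp j * β.ofLp k) ∂Pβ
        = τ ^ 2 * (CFC.sqrt S i j * CFC.sqrt S j i) := fun j => by
      rw [integral_finsetSum _ fun k _ => hint i j k]
      simp_rw [integral_const_mul, hPβ.secondMoment]
      have h3 : CFC.sqrt S j i = CFC.sqrt S i j := congrFun (congrFun (transpose_sqrt S) i) j
      rw [Finset.sum_eq_single j (fun k _ hk => by simp [Matrix.one_apply_ne hk.symm]) (by simp),
        Matrix.one_apply_eq, h3]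
      ring
    simp_rw [h2]
    rw [← Finset.mul_sum, ← Matrix.mul_apply, hRR]
  simp_rw [h1]
  rw [← Finset.mul_sum]
  rfl

theorem reducibleError_mixedEstimator {σ τ : ℝ} (α : ℝ) (hp : p + 2 ≤ n)
    {S : Matrix (Fin p) (Fin p) ℝ} (hS : S.PosDef) {Pβ : Measure (EuclideanSpace ℝ (Fin p))}
    (hPβ : IsIsotropicPrior τ Pβ)
    {κ : Kernel (EuclideanSpace ℝ (Fin p) × EuclideanSpace ℝ (Fin p)) ℝ}
    (hκ : IsLinearResponse σ Pβ (multivariateGaussian 0 S) κ) :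
    reducibleError Pβ (multivariateGaussian 0 S) κ
        (mixedEstimator (n := n) (multivariateGaussian 0 S) α)
      = ENNReal.ofReal (mixedRisk n p σ (τ ^ 2 * S.trace) α) := by
  have := hκ.isMarkovKernel
  have := hPβ.isProbabilityMeasure
  obtain ⟨hi, hv⟩ := integral_mulVec_sqrt_sq hPβ hS
  have hae := (hκ.memLp.and (hκ.mean.and hκ.variance)).mono fun β h =>
    lintegral_mixedEstimator_of_coefficient (n := n) (σ := σ) α hp hS κ h.1 h.2.1 h.2.2
  rw [reducibleError, lintegral_congr_ae (hae.mono fun β h => h.2),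
    ← ofReal_integral_eq_lintegral_ofReal _ (hae.mono fun β h => h.1)]
  · congr 1
    simp only [mixedRisk]
    rw [integral_add ((hi.const_mul _).const_mul _) (integrable_const _), integral_const_mul,
      integral_const_mul, hv]
    simp
  · exact ((hi.const_mul _).const_mul _).add (integrable_const _)

lemma mixedEstimator_zero (Px : Measure (EuclideanSpace ℝ (Fin p))) :
    mixedEstimator (n := n) Px 0 = supervisedEstimator := by
  ext xs y
  simp [mixedEstimator]

end

/-! ### Optimal mixing and limits -/

/-- The reducible error of the supervised estimator. -/
noncomputable def supervisedRisk (n p : ℕ) (σ : ℝ) : ℝ := σ ^ 2 * (p / ((n : ℝ) - p - 1))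

/-- The noise part of the reducible error of the semi-supervised estimator. It is also the
covariance of the errors of the two estimators. -/
noncomputable def semiSupervisedNoise (n p : ℕ) (σ : ℝ) : ℝ :=
  σ ^ 2 * (p * ((n : ℝ) - 1) / (n : ℝ) ^ 2)

/-- The bias part of the reducible error of the semi-supervised estimator, for the signal strength
`t = τ² tr Σ`. -/
noncomputable def semiSupervisedBias (n p : ℕ) (t : ℝ) : ℝ := deviationFactor (n - 1) p n * t

lemma mixedRisk_eq {n : ℕ} (hn : n ≠ 0) (p : ℕ) (σ t α : ℝ) :
    mixedRisk n p σ t α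
      = supervisedRisk n p σ - 2 * α * (supervisedRisk n p σ - semiSupervisedNoise n p σ)
        + α ^ 2 * (supervisedRisk n p σ - semiSupervisedNoise n p σ
          + semiSupervisedBias n p t) := by
  have hn' : (n : ℝ) ≠ 0 := by exact_mod_cast hn
  have e1 : 2 * (1 - α) * α / n * (p - p / n)
      = 2 * (1 - α) * α * (p * ((n : ℝ) - 1) / (n : ℝ) ^ 2) := by field_simp
  have e2 : α ^ 2 / (n : ℝ) ^ 2 * (p * ((n : ℝ) - 1))
      = α ^ 2 * (p * ((n : ℝ) - 1) / (n : ℝ) ^ 2) := by field_simp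
  rw [mixedRisk, e1, e2, supervisedRisk, semiSupervisedNoise, semiSupervisedBias]
  ring

lemma semiSupervisedBias_nonneg {n p : ℕ} (hp : 1 ≤ p) {t : ℝ} (ht : 0 ≤ t) :
    0 ≤ semiSupervisedBias n p t := by
  have h1 : (0 : ℝ) ≤ (p : ℝ) - 1 := by
    have : (1 : ℝ) ≤ p := by exact_mod_cast hp
    linarith
  have h2 : 0 ≤ gaussianSqVariance := variance_nonneg _ _
  rw [semiSupervisedBias, deviationFactor]
  positivity

lemma semiSupervisedNoise_nonneg {n p : ℕ} (hp : p + 2 ≤ n) (σ : ℝ) :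
    0 ≤ semiSupervisedNoise n p σ := by
  have h1 : (0 : ℝ) ≤ (n : ℝ) - 1 := by
    have : (p : ℝ) + 2 ≤ n := by exact_mod_cast hp
    linarith [(Nat.cast_nonneg p : (0 : ℝ) ≤ p)]
  rw [semiSupervisedNoise]
  positivity

lemma semiSupervisedNoise_lt_supervisedRisk {n p : ℕ} (hp1 : 1 ≤ p) (hp : p + 2 ≤ n) {σ : ℝ}
    (hσ : 0 < σ) : semiSupervisedNoise n p σ < supervisedRisk n p σ := by
  have h1 : (1 : ℝ) ≤ p := by exact_mod_cast hp1
  have h2 : (p : ℝ) + 2 ≤ n := by exact_mod_cast hp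
  have h3 : (0 : ℝ) < (n : ℝ) - p - 1 := by linarith
  have h4 : (0 : ℝ) < n := by linarith
  refine mul_lt_mul_of_pos_left ?_ (by positivity)
  rw [div_lt_div_iff₀ (by positivity) h3]
  nlinarith [mul_pos (by linarith : (0 : ℝ) < p) h4, mul_pos (by linarith : (0 : ℝ) < p) h3,
    mul_nonneg (mul_nonneg (by linarith : (0 : ℝ) ≤ p) (by linarith : (0 : ℝ) ≤ p)) h4.le]

section Quadratic

variable {a d v : ℝ}

lemma quadratic_eq_completed_square (h : d + v ≠ 0) (α : ℝ) :
    a - 2 * α * d + α ^ 2 * (d + v)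
      = (d + v) * (α - d / (d + v)) ^ 2 + (a - d ^ 2 / (d + v)) := by
  field_simp
  ring

lemma quadratic_min_nonneg (hd : 0 < d) (had : d ≤ a) (hv : 0 ≤ v) :
    0 ≤ a - d ^ 2 / (d + v) := by
  have : d ^ 2 / (d + v) ≤ d := by
    rw [div_le_iff₀ (by linarith)]
    nlinarith
  linarith

lemma forall_ofReal_quadratic_le_iff (hd : 0 < d) (had : d ≤ a) (hv : 0 ≤ v) (α : ℝ) :
    (∀ α', ENNReal.ofReal (a - 2 * α * d + α ^ 2 * (d + v))
      ≤ ENNReal.ofReal (a - 2 * α' * d + α' ^ 2 * (d + v))) ↔ α = d / (d + v) := by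
  have hdv : 0 < d + v := by linarith
  have hmin := quadratic_min_nonneg hd had hv
  simp_rw [quadratic_eq_completed_square (a := a) hdv.ne']
  constructor
  · intro h
    have h1 := h (d / (d + v))
    rw [ENNReal.ofReal_le_ofReal_iff (by simpa using hmin), sub_self] at h1
    have h2 : (d + v) * (α - d / (d + v)) ^ 2 ≤ 0 := by linarith
    have h3 : (α - d / (d + v)) ^ 2 ≤ 0 := by
      by_contra h4
      push Not at h4
      linarith [mul_pos hdv h4]
    exact sub_eq_zero.1 (pow_eq_zero_iff two_ne_zero |>.1 (le_antisymm h3 (sq_nonneg _)))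
  · rintro rfl α'
    refine ENNReal.ofReal_le_ofReal ?_
    rw [sub_self]
    nlinarith [mul_nonneg hdv.le (sq_nonneg (α' - d / (d + v)))]

end Quadratic

section FixedSize

variable {n p : ℕ} {σ τ : ℝ} {S : Matrix (Fin p) (Fin p) ℝ}
  {Pβ : Measure (EuclideanSpace ℝ (Fin p))}
  {κ : Kernel (EuclideanSpace ℝ (Fin p) × EuclideanSpace ℝ (Fin p)) ℝ}

lemma reducibleError_supervisedEstimator (hp : p + 2 ≤ n) (hS : S.PosDef)
    (hPβ : IsIsotropicPrior τ Pβ) (hκ : IsLinearResponse σ Pβ (multivariateGaussian 0 S) κ) :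
    reducibleError Pβ (multivariateGaussian 0 S) κ (supervisedEstimator (n := n))
      = ENNReal.ofReal (supervisedRisk n p σ) := by
  rw [← mixedEstimator_zero, reducibleError_mixedEstimator 0 hp hS hPβ hκ,
    mixedRisk_eq (by omega)]
  simp

/-- The optimal mixing ratio for the sample size `n`, the dimension `p`, the noise level `σ` and the
signal strength `t = τ² tr Σ`. -/
noncomputable def optimalRatio (n p : ℕ) (σ t : ℝ) : ℝ :=
  (supervisedRisk n p σ - semiSupervisedNoise n p σ)
    / (supervisedRisk n p σ - semiSupervisedNoise n p σ + semiSupervisedBias n p t)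

lemma isOptimalMixingRatio_iff (hσ : 0 < σ) (hp1 : 1 ≤ p) (hp : p + 2 ≤ n) (hS : S.PosDef)
    (hPβ : IsIsotropicPrior τ Pβ) (hκ : IsLinearResponse σ Pβ (multivariateGaussian 0 S) κ)
    (α : ℝ) :
    IsOptimalMixingRatio n Pβ (multivariateGaussian 0 S) κ α
      ↔ α = optimalRatio n p σ (τ ^ 2 * S.trace) := by
  have hn : n ≠ 0 := by omega
  simp only [IsOptimalMixingRatio, reducibleError_mixedEstimator _ hp hS hPβ hκ,
    mixedRisk_eq hn]
  refine forall_ofReal_quadratic_le_iff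
    (sub_pos.2 (semiSupervisedNoise_lt_supervisedRisk hp1 hp hσ)) ?_ ?_ α
  · linarith [semiSupervisedNoise_nonneg hp σ]
  · exact semiSupervisedBias_nonneg hp1 (mul_nonneg (sq_nonneg τ) hS.posSemidef.trace_nonneg)

lemma relativeError_optimalRatio (hσ : 0 < σ) (hp1 : 1 ≤ p) (hp : p + 2 ≤ n) (hS : S.PosDef)
    (hPβ : IsIsotropicPrior τ Pβ) (hκ : IsLinearResponse σ Pβ (multivariateGaussian 0 S) κ) :
    relativeError n Pβ (multivariateGaussian 0 S) κ (optimalRatio n p σ (τ ^ 2 * S.trace))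
      = 1 - optimalRatio n p σ (τ ^ 2 * S.trace)
        * (supervisedRisk n p σ - semiSupervisedNoise n p σ) / supervisedRisk n p σ := by
  have hd := sub_pos.2 (semiSupervisedNoise_lt_supervisedRisk hp1 hp hσ)
  have hC := semiSupervisedNoise_nonneg hp σ
  have hA : 0 < supervisedRisk n p σ := by linarith
  have hv := semiSupervisedBias_nonneg (n := n) hp1
    (mul_nonneg (sq_nonneg τ) hS.posSemidef.trace_nonneg)
  have hdv := (add_pos_of_pos_of_nonneg hd hv).ne'
  rw [relativeError, reducibleError_supervisedEstimator hp hS hPβ hκ,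
    reducibleError_mixedEstimator _ hp hS hPβ hκ, mixedRisk_eq (by omega),
    quadratic_eq_completed_square hdv, optimalRatio, sub_self, ENNReal.toReal_div,
    ENNReal.toReal_ofReal hA.le, ENNReal.toReal_ofReal]
  · field_simp
    ring
  · simpa using quadratic_min_nonneg hd (by linarith) hv

lemma optimalRatio_mem_Icc (hσ : 0 < σ) (hp1 : 1 ≤ p) (hp : p + 2 ≤ n) {t : ℝ} (ht : 0 ≤ t) :
    optimalRatio n p σ t ∈ Set.Icc (0 : ℝ) 1 := by
  have hd := sub_pos.2 (semiSupervisedNoise_lt_supervisedRisk hp1 hp hσ)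
  have hv := semiSupervisedBias_nonneg (n := n) hp1 ht
  exact ⟨div_nonneg hd.le (by linarith), div_le_one_of_le₀ (by linarith) (by linarith)⟩

end FixedSize

section Limits

variable {γ : ℝ} {n p : ℕ → ℕ}

lemma eventually_one_le_and_add_two_le (hγ0 : 0 < γ) (hγ1 : γ < 1) (hn : Tendsto n atTop atTop)
    (hp : Tendsto (fun k => (p k : ℝ) / (n k : ℝ)) atTop (𝓝 γ)) :
    ∀ᶠ k in atTop, 1 ≤ p k ∧ p k + 2 ≤ n k := by
  have hn' : Tendsto (fun k => (n k : ℝ)) atTop atTop := tendsto_natCast_atTop_atTop.comp hn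
  have h1 : Tendsto (fun k => (p k : ℝ) / n k + 2 * (n k : ℝ)⁻¹) atTop (𝓝 γ) := by
    simpa using hp.add ((tendsto_inv_atTop_zero.comp hn').const_mul 2)
  filter_upwards [hp.eventually_const_lt hγ0, h1.eventually_lt_const hγ1,
    hn'.eventually_gt_atTop 0] with k h2 h3 h4
  constructor
  -- If `p k = 0` then the ratio vanishes, but it is eventually positive.
  · by_contra h5
    have : p k = 0 := by omega
    simp [this] at h2
  · have h5 : ((p k : ℝ) + 2) / n k < 1 := by
      rw [add_div, div_eq_mul_inv 2]
      exact h3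
    rw [div_lt_one h4] at h5
    have : ((p k + 2 : ℕ) : ℝ) < n k := by push_cast; exact h5
    exact_mod_cast this.le

lemma tendsto_supervisedRisk (σ : ℝ) (hγ1 : γ < 1) (hn : Tendsto n atTop atTop)
    (hp : Tendsto (fun k => (p k : ℝ) / (n k : ℝ)) atTop (𝓝 γ)) :
    Tendsto (fun k => supervisedRisk (n k) (p k) σ) atTop (𝓝 (σ ^ 2 * (γ / (1 - γ)))) := by
  have hn' : Tendsto (fun k => (n k : ℝ)) atTop atTop := tendsto_natCast_atTop_atTop.comp hn
  have h1 : Tendsto (fun k => 1 - (p k : ℝ) / n k - (n k : ℝ)⁻¹) atTop (𝓝 (1 - γ)) := by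
    simpa using (hp.const_sub 1).sub (tendsto_inv_atTop_zero.comp hn')
  refine ((hp.div h1 (by linarith)).const_mul (σ ^ 2)).congr' ?_
  filter_upwards [hn'.eventually_gt_atTop 0] with k hk
  simp only [supervisedRisk, Pi.div_apply]
  have e : 1 - (p k : ℝ) / n k - (n k : ℝ)⁻¹ = ((n k : ℝ) - p k - 1) / n k := by field_simp
  rw [e, div_div_div_cancel_right₀ hk.ne']

lemma tendsto_semiSupervisedNoise (σ : ℝ) (hn : Tendsto n atTop atTop)
    (hp : Tendsto (fun k => (p k : ℝ) / (n k : ℝ)) atTop (𝓝 γ)) :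
    Tendsto (fun k => semiSupervisedNoise (n k) (p k) σ) atTop (𝓝 (σ ^ 2 * γ)) := by
  have hn' : Tendsto (fun k => (n k : ℝ)) atTop atTop := tendsto_natCast_atTop_atTop.comp hn
  have h1 := (hp.mul ((tendsto_inv_atTop_zero.comp hn').const_sub 1)).const_mul (σ ^ 2)
  rw [sub_zero, mul_one] at h1
  refine h1.congr' ?_
  filter_upwards [hn'.eventually_gt_atTop 0] with k hk
  simp only [semiSupervisedNoise, Function.comp_apply]
  field_simp

lemma tendsto_semiSupervisedBias {t : ℕ → ℝ} {T : ℝ} (ht : Tendsto t atTop (𝓝 T))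
    (hn : Tendsto n atTop atTop)
    (hp : Tendsto (fun k => (p k : ℝ) / (n k : ℝ)) atTop (𝓝 γ)) :
    Tendsto (fun k => semiSupervisedBias (n k) (p k) (t k)) atTop (𝓝 (γ * T)) := by
  have hn' : Tendsto (fun k => (n k : ℝ)) atTop atTop := tendsto_natCast_atTop_atTop.comp hn
  have hu : Tendsto (fun k => (n k : ℝ)⁻¹) atTop (𝓝 0) := tendsto_inv_atTop_zero.comp hn'
  have h1 : Tendsto (fun k => (1 - (n k : ℝ)⁻¹) * (n k : ℝ)⁻¹ * gaussianSqVariance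
      + (n k : ℝ)⁻¹ ^ 2 + ((p k : ℝ) / n k - (n k : ℝ)⁻¹) * (1 - (n k : ℝ)⁻¹)) atTop (𝓝 γ) := by
    have := ((((hu.const_sub 1).mul hu).mul_const gaussianSqVariance).add (hu.pow 2)).add
      ((hp.sub hu).mul (hu.const_sub 1))
    simpa using this
  refine (h1.mul ht).congr' ?_
  filter_upwards [hn'.eventually_gt_atTop 0, hn.eventually_ge_atTop 1] with k hk hk1
  rw [semiSupervisedBias, deviationFactor, Nat.cast_sub hk1]
  congr 1
  push_cast
  field_simp
  ring

end Limits

end MixedSSL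

theorem mainTheorem11
    (γ σ τ c : ℝ) (hγ0 : 0 < γ) (hγ1 : γ < 1) (hσ : 0 < σ)
    -- the sample sizes and the dimensions along the asymptotic regime
    (n p : ℕ → ℕ) (hn : Tendsto n atTop atTop)
    (hp : Tendsto (fun k => (p k : ℝ) / (n k : ℝ)) atTop (𝓝 γ))
    -- the covariance matrices of the covariates
    (S : (k : ℕ) → Matrix (Fin (p k)) (Fin (p k)) ℝ)
    (hS : ∀ k, (S k).PosDef)
    (htr : Tendsto (fun k => (S k).trace) atTop (𝓝 (c ^ 2)))
    (Px : (k : ℕ) → Measure (EuclideanSpace ℝ (Fin (p k))))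
    (hPx : ∀ k, Px k = multivariateGaussian 0 (S k))
    -- the prior of the coefficients and the conditional law of the response
    (Pβ : (k : ℕ) → Measure (EuclideanSpace ℝ (Fin (p k))))
    (hPβ : ∀ k, MixedSSL.IsIsotropicPrior τ (Pβ k))
    (κ : (k : ℕ) →
      Kernel (EuclideanSpace ℝ (Fin (p k)) × EuclideanSpace ℝ (Fin (p k))) ℝ)
    (hκ : ∀ k, MixedSSL.IsLinearResponse σ (Pβ k) (Px k) (κ k)) :
    -- `η` and `α*` are eventually well defined
    (∀ᶠ k in atTop,
      0 < MixedSSL.reducibleError (Pβ k) (Px k) (κ k)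
        (MixedSSL.supervisedEstimator (n := n k)) ∧
      MixedSSL.reducibleError (Pβ k) (Px k) (κ k)
        (MixedSSL.supervisedEstimator (n := n k)) < ∞ ∧
      ∃! α : ℝ, MixedSSL.IsOptimalMixingRatio (n k) (Pβ k) (Px k) (κ k) α) ∧
    -- the limits, for the optimal mixing ratios `α k = α*`
    (∀ α : ℕ → ℝ,
      (∀ᶠ k in atTop,
        MixedSSL.IsOptimalMixingRatio (n k) (Pβ k) (Px k) (κ k) (α k)) →
      (∀ᶠ k in atTop, α k ∈ Set.Icc (0 : ℝ) 1) ∧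
      Tendsto (fun k => MixedSSL.relativeError (n k) (Pβ k) (Px k) (κ k) (α k)) atTop
        (𝓝 (1 - γ ^ 4 * σ ^ 2 /
          ((1 - γ) * γ ^ 2 * τ ^ 2 * c ^ 2 + γ ^ 3 * σ ^ 2))) ∧
      Tendsto α atTop
        (𝓝 (γ ^ 2 * σ ^ 2 / ((1 - γ) * γ * τ ^ 2 * c ^ 2 + γ ^ 2 * σ ^ 2)))) ∧
    1 - γ ^ 4 * σ ^ 2 / ((1 - γ) * γ ^ 2 * τ ^ 2 * c ^ 2 + γ ^ 3 * σ ^ 2) < 1 := by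
  obtain rfl : Px = fun k => multivariateGaussian 0 (S k) := funext hPx
  have hsize := MixedSSL.eventually_one_le_and_add_two_le hγ0 hγ1 hn hp
  have hγ' : 0 < 1 - γ := sub_pos.2 hγ1
  have hA := MixedSSL.tendsto_supervisedRisk σ hγ1 hn hp
  have hC := MixedSSL.tendsto_semiSupervisedNoise σ hn hp
  have hB := MixedSSL.tendsto_semiSupervisedBias (htr.const_mul (τ ^ 2)) hn hp
  have hA0 : 0 < σ ^ 2 * (γ / (1 - γ)) := by positivity
  have hd : σ ^ 2 * (γ / (1 - γ)) - σ ^ 2 * γ = σ ^ 2 * γ ^ 2 / (1 - γ) := by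
    field_simp
    ring
  have hd0 : 0 < σ ^ 2 * γ ^ 2 / (1 - γ) := by positivity
  have hD0 : 0 < σ ^ 2 * γ ^ 2 / (1 - γ) + γ * (τ ^ 2 * c ^ 2) := by positivity
  have hratio : Tendsto (fun k => MixedSSL.optimalRatio (n k) (p k) σ (τ ^ 2 * (S k).trace)) atTop
      (𝓝 (γ ^ 2 * σ ^ 2 / ((1 - γ) * γ * τ ^ 2 * c ^ 2 + γ ^ 2 * σ ^ 2))) := by
    have h := (hA.sub hC).div ((hA.sub hC).add hB) (by rw [hd]; exact hD0.ne')
    have e : σ ^ 2 * γ ^ 2 / (1 - γ) + γ * (τ ^ 2 * c ^ 2)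
        = ((1 - γ) * γ * τ ^ 2 * c ^ 2 + γ ^ 2 * σ ^ 2) / (1 - γ) := by
      field_simp
      ring
    rw [hd, e, div_div_div_cancel_right₀ hγ'.ne', mul_comm (σ ^ 2)] at h
    exact h
  refine ⟨?_, fun α hα => ?_, ?_⟩
  · filter_upwards [hsize] with k hk
    rw [MixedSSL.reducibleError_supervisedEstimator hk.2 (hS k) (hPβ k) (hκ k)]
    refine ⟨ENNReal.ofReal_pos.2 ?_, ENNReal.ofReal_lt_top,
      MixedSSL.optimalRatio (n k) (p k) σ (τ ^ 2 * (S k).trace), ?_, fun α' h => ?_⟩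
    · linarith [MixedSSL.semiSupervisedNoise_nonneg hk.2 σ,
        MixedSSL.semiSupervisedNoise_lt_supervisedRisk hk.1 hk.2 hσ]
    · exact (MixedSSL.isOptimalMixingRatio_iff hσ hk.1 hk.2 (hS k) (hPβ k) (hκ k) _).2 rfl
    · exact (MixedSSL.isOptimalMixingRatio_iff hσ hk.1 hk.2 (hS k) (hPβ k) (hκ k) _).1 h
  · have hopt : ∀ᶠ k in atTop,
        α k = MixedSSL.optimalRatio (n k) (p k) σ (τ ^ 2 * (S k).trace) := by
      filter_upwards [hsize, hα] with k hk h
      exact (MixedSSL.isOptimalMixingRatio_iff hσ hk.1 hk.2 (hS k) (hPβ k) (hκ k) _).1 h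
    refine ⟨?_, ?_, hratio.congr' (hopt.mono fun k h => h.symm)⟩
    · filter_upwards [hsize, hopt] with k hk h
      rw [h]
      exact MixedSSL.optimalRatio_mem_Icc hσ hk.1 hk.2
        (mul_nonneg (sq_nonneg τ) (hS k).posSemidef.trace_nonneg)
    · have h := ((hratio.mul (hA.sub hC)).div hA hA0.ne').const_sub 1
      rw [hd] at h
      convert h.congr' ?_ using 2
      · have h1 : (0 : ℝ) < (1 - γ) * γ * τ ^ 2 * c ^ 2 + γ ^ 2 * σ ^ 2 := by positivity
        have h2 : (0 : ℝ) < (1 - γ) * γ ^ 2 * τ ^ 2 * c ^ 2 + γ ^ 3 * σ ^ 2 := by positivity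
        field_simp
      · filter_upwards [hsize, hopt] with k hk hk'
        rw [hk', MixedSSL.relativeError_optimalRatio hσ hk.1 hk.2 (hS k) (hPβ k) (hκ k)]
        rfl
  · have : 0 < γ ^ 4 * σ ^ 2 / ((1 - γ) * γ ^ 2 * τ ^ 2 * c ^ 2 + γ ^ 3 * σ ^ 2) := by positivity
    linarith
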